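/- Let $\mathcal X\subset\mathbb R^d$ be compact, let $k(x,x')=\kappa(x-x')$ be a stationary kernel, and let $f\sim\mathcal{GP}(\mu,k)$ be a Gaussian process on $\mathcal X$ whose sample paths are almost surely continuous. Let $n\ge 1$, let $X_n=(x_1,\dots,x_n)$ be points of $\mathcal X$ such that $K_{n,n}=k(X_n,X_n)$ is invertible, let $y\in\mathbb R^n$, and put $\xi(x)=K_{n,n}^{-1}k(X_n,x)$. For a process $g$ on $\mathcal X$ let $(g\mid y)(x)=g(x)+\xi(x)^\top(y-g(X_n))$ be its pathwise update, let $k^{(g)}(x,x')=\mathbb E\big[(g(x)-\mathbb E g(x))\overline{(g(x')-\mathbb E g(x'))}\big]$ be its covariance function, and let $\|c\|_\infty=\sup_{x,x'\in\mathcal X}|c(x,x')|$. Put $$C_2=n\big(1+\|K_{n,n}^{-1}\|_{L(\ell^\infty;\ell^1)}\,\|k\|_\infty\big)^2 ,$$ with the operator norm of $K_{n,n}^{-1}$ as a map from $\ell^\infty$ to $\ell^1$. (0) $k^{(f\mid y)}$ is the true posterior covariance: for all $x,x'\in\mathcal X$, the conditional covariance of $f(x)$ and $f(x')$ given $f(X_n)$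 is almost surely equal to $k^{(f\mid y)}(x,x')$. (This part also holds for $n=0$.) (1) Let $\tilde f(x)=\sum_{i=1}^{\ell}w_i\phi_i(x)$ be an approximate prior, where $\phi=(\phi_1,\dots,\phi_\ell)$ is a random tuple of continuous real or complex valued functions on $\mathcal X$ and the weights $w\sim\mathcal N(0,\Sigma_w)$ are real and independent of $\phi$. With $k^{(\tilde f)}$ and $k^{(\tilde f\mid y)}$ the covariance functions for given $\phi$ (over the randomness of $w$), $$\mathbb E_\phi\big\|k^{(\tilde f\mid y)}-k^{(f\mid y)}\big\|_\infty\le C_2\,\mathbb E_\phi\big\|k^{(\tilde f)}-k\big\|_\infty .$$ (2) Suppose moreover that $k$ has a spectral density: an integrable $\rho\ge 0$ on $\mathbb R^d$ with $\kappa(t)=\int e^{2\pi i\,\omega^\top t}\rho(\omega)\,d\omega$ for all $t\in\mathbb R^d$, and that $\int\|\omega\|^{\alpha}\rho(\omega)\,d\omega<\infty$ for some $\alpha>0$. Then there is a constant $C_3\ge 0$, which does not depend on $\ell$, $n$, $X_n$ or $y$, such that for every $\ell\ge 1$ and for the random Fourier feature approximation $\tilde f=\sum_{j=1}^\ell w_j\phi_j$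 with $w\sim\mathcal N(0,I)$ independent of $\phi$, $$\mathbb E_\phi\big\|k^{(\tilde f)}-k\big\|_\infty\le \ell^{-1/2}C_3,\qquad \mathbb E_\phi\big\|k^{(\tilde f\mid y)}-k^{(f\mid y)}\big\|_\infty\le \ell^{-1/2}C_2C_3 ,$$ the second for all $n$, $X_n$, $y$ as above. Here the features are either complex, $\phi_j(x)=\sqrt{\kappa(0)/\ell}\;e^{2\pi i\,\omega_j^\top x}$, or real, $\phi_j(x)=\sqrt{2\kappa(0)/\ell}\,\cos(2\pi\omega_j^\top x+\tau_j)$, where $\omega_1,\dots,\omega_\ell$ are i.i.d. with density $\rho/\kappa(0)$ and, in the real case, $\tau_1,\dots,\tau_\ell$ are i.i.d. uniform on $(0,2\pi)$ and independent of the $\omega_j$. -/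

import Mathlib

open MeasureTheory ProbabilityTheory
open scoped ENNReal

noncomputable section

namespace PathwiseGP

/-- The supremum norm `sup_{x, x'} ‖c(x, x')‖` of a function on `X × X`, as an extended nonnegative
real. For continuous `c` on a compact space it is the norm of `C(X²)`. -/
def supNorm {X E : Type*} [NormedAddCommGroup E] (c : X → X → E) : ℝ≥0∞ :=
  ⨆ x, ⨆ x', ‖c x x'‖ₑ

/-- The covariance function `(x, x') ↦ E[(g(x) - E g(x)) * conj (g(x') - E g(x'))]` of a real or
complex valued process `g`. -/
def covFun {X Ω 𝕜 : Type*} [RCLike 𝕜] [MeasurableSpace Ω] (P : Measure Ω) (g : X → Ω → 𝕜)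
    (x x' : X) : 𝕜 :=
  ∫ ω, (g x ω - ∫ ω', g x ω' ∂P) * (starRingEnd 𝕜) (g x' ω - ∫ ω', g x' ω' ∂P) ∂P

/-- `f ∼ GP(μ, k)` under `P`. -/
structure IsGP {X Ω : Type*} [MeasurableSpace Ω] (P : Measure Ω) (f : X → Ω → ℝ)
    (μ : X → ℝ) (k : X → X → ℝ) : Prop where
  measurable : ∀ x, Measurable (f x)
  gaussian : IsGaussianProcess f P
  mean_eq : ∀ x, ∫ ω, f x ω ∂P = μ x
  cov_eq : ∀ x x', covariance (f x) (f x') P = k x x'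

/-- The stationary kernel `k(x, x') = κ(x - x')` on a subset `X` of `ℝᵈ`. -/
def statKernel {d : ℕ} (X : Set (EuclideanSpace ℝ (Fin d))) (κ : EuclideanSpace ℝ (Fin d) → ℝ) :
    X → X → ℝ :=
  fun x x' => κ (x.1 - x'.1)

/-- The matrix `K_{n,n} = k(X_n, X_n)`. -/
def gram {X : Type*} {n : ℕ} (k : X → X → ℝ) (Xn : Fin n → X) : Matrix (Fin n) (Fin n) ℝ :=
  Matrix.of fun i j => k (Xn i) (Xn j)

/-- The weight function `ξ(x) = K_{n,n}⁻¹ k(X_n, x)`. -/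
def weight {X : Type*} {n : ℕ} (k : X → X → ℝ) (Xn : Fin n → X) (x : X) : Fin n → ℝ :=
  Matrix.mulVec (gram k Xn)⁻¹ fun j => k (Xn j) x

/-- Pathwise conditioning of a process `g` on the values `y` at `X_n`, with the canonical basis of
the kernel `k`: the process `(g | y)(x) = g(x) + ξ(x)ᵀ (y - g(X_n))`. -/
def pathwise {X Ω 𝕜 : Type*} [RCLike 𝕜] {n : ℕ} (k : X → X → ℝ) (Xn : Fin n → X) (y : Fin n → ℝ)
    (g : X → Ω → 𝕜) : X → Ω → 𝕜 :=
  fun x ω => g x ω + ∑ i, ((weight k Xn x i : ℝ) : 𝕜) * (((y i : ℝ) : 𝕜) - g (Xn i) ω)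

/-- The operator norm of a matrix as a map from `ℓ^∞` to `ℓ^1`. -/
def opNormInftyOne {n : ℕ} (A : Matrix (Fin n) (Fin n) ℝ) : ℝ :=
  ‖LinearMap.toContinuousLinearMap
    (((WithLp.linearEquiv 1 ℝ (Fin n → ℝ)).symm : (Fin n → ℝ) →ₗ[ℝ] PiLp 1 fun _ : Fin n => ℝ) ∘ₗ
      Matrix.toLin' A)‖

/-- `C₂ = n (1 + ‖K_{n,n}⁻¹‖ ‖k‖)²`, with the operator norm `ℓ^∞ → ℓ^1` and the supremum norm. -/
def constTwo {X : Type*} {n : ℕ} (k : X → X → ℝ) (Xn : Fin n → X) : ℝ :=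
  n * (1 + opNormInftyOne (gram k Xn)⁻¹ * (supNorm k).toReal) ^ 2

/-- The linear model `f̃(x) = ∑ i, w_i φ_i(x)`, for a fixed basis `φ` and random real weights. -/
def linearModel {X Ω 𝕜 : Type*} [RCLike 𝕜] {l : ℕ} (φ : Fin l → X → 𝕜)
    (w : Ω → EuclideanSpace ℝ (Fin l)) : X → Ω → 𝕜 :=
  fun x ω => ∑ i, ((w ω i : ℝ) : 𝕜) * φ i x

/-- `‖k^(f̃) - k‖`: the error of the covariance function of the approximate prior `g`. -/
def priorError {X Ω 𝕜 : Type*} [RCLike 𝕜] [MeasurableSpace Ω] (k : X → X → ℝ)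
    (Pw : Measure Ω) (g : X → Ω → 𝕜) : ℝ≥0∞ :=
  supNorm fun x x' => covFun Pw g x x' - ((k x x' : ℝ) : 𝕜)

/-- `‖k^(f̃ | y) - k^(f | y)‖`: the error of the covariance function of the approximate posterior
obtained from the approximate prior `g`. -/
def posteriorError {X Ω Ω' 𝕜 : Type*} [RCLike 𝕜] [MeasurableSpace Ω] [MeasurableSpace Ω'] {n : ℕ}
    (k : X → X → ℝ) (Xn : Fin n → X) (y : Fin n → ℝ) (P : Measure Ω) (f : X → Ω → ℝ)
    (Pw : Measure Ω') (g : X → Ω' → 𝕜) : ℝ≥0∞ :=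
  supNorm fun x x' =>
    covFun Pw (pathwise k Xn y g) x x' - ((covFun P (pathwise k Xn y f) x x' : ℝ) : 𝕜)

/-- The conditional covariance of `f(x)` and `f(x')` given the values of the process at `X_n`. -/
def condCov {X Ω : Type*} [MeasurableSpace Ω] {n : ℕ} (P : Measure Ω) (f : X → Ω → ℝ)
    (Xn : Fin n → X) (x x' : X) : Ω → ℝ :=
  let m : MeasurableSpace Ω := MeasurableSpace.comap (fun ω i => f (Xn i) ω) inferInstance
  P[fun ω => (f x ω - (P[f x | m]) ω) * (f x' ω - (P[f x' | m]) ω) | m]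

/-- `ρ` is a spectral density of the stationary kernel given by `κ`. -/
structure IsSpectralDensity {d : ℕ} (κ ρ : EuclideanSpace ℝ (Fin d) → ℝ) : Prop where
  nonneg : ∀ ω, 0 ≤ ρ ω
  integrable : Integrable ρ
  eq_integral : ∀ t, (κ t : ℂ) =
    ∫ ω, Complex.exp (2 * Real.pi * Complex.I * (inner ℝ ω t : ℝ)) * (ρ ω : ℂ)

/-- The law of the random frequencies: the density `ρ`, normalised by its mass `κ(0) = ∫ ρ`. -/
def freqLaw {d : ℕ} (κ ρ : EuclideanSpace ℝ (Fin d) → ℝ) : Measure (EuclideanSpace ℝ (Fin d)) :=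
  volume.withDensity fun ω => ENNReal.ofReal (ρ ω / κ 0)

/-- The uniform distribution on `(0, 2π)`. -/
def phaseLaw : Measure ℝ :=
  ProbabilityTheory.cond volume (Set.Ioo 0 (2 * Real.pi))

/-- Complex random Fourier features `φ_j(x) = (κ(0)/ℓ)^{1/2} exp(2πi ω_jᵀ x)`; the amplitude is
`ℓ^{-1/2}` for a kernel with `κ(0) = 1`. -/
def rffComplex {d l : ℕ} (X : Set (EuclideanSpace ℝ (Fin d))) (κ : EuclideanSpace ℝ (Fin d) → ℝ)
    (ω : Fin l → EuclideanSpace ℝ (Fin d)) : Fin l → X → ℂ :=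
  fun j x => (Real.sqrt (κ 0 / l) : ℂ) *
    Complex.exp (2 * Real.pi * Complex.I * (inner ℝ (ω j) x.1 : ℝ))

/-- Real random Fourier features `φ_j(x) = (2κ(0)/ℓ)^{1/2} cos(2π ω_jᵀ x + τ_j)`; the amplitude is
`(2/ℓ)^{1/2}` for a kernel with `κ(0) = 1`. -/
def rffReal {d l : ℕ} (X : Set (EuclideanSpace ℝ (Fin d))) (κ : EuclideanSpace ℝ (Fin d) → ℝ)
    (θ : Fin l → EuclideanSpace ℝ (Fin d) × ℝ) : Fin l → X → ℝ :=
  fun j x => Real.sqrt (2 * κ 0 / l) * Real.cos (2 * Real.pi * inner ℝ (θ j).1 x.1 + (θ j).2)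

end PathwiseGP

end

open PathwiseGP

/-!
The pathwise update `g ↦ (g ∣ y)` is affine in `g`, so that it acts on covariance functions by a
linear operator (`covFun_pathwise`): up to a deterministic shift, `(g ∣ y)(x)` is the linear
combination of `g(x)` and the `g(x_i)` with coefficients `1` and `-ξ_i(x)`. This
reduces the three claims as follows.

* For the Gaussian process itself this combination is the residual of the linear prediction of
  `f(x)` from the data. It is uncorrelated with the data, as `K_{n,n} ξ(x) = k(X_n, x)`, hence
  independent of them, and the conditional covariance is the covariance of the residuals
  (`IsGP.condCov_ae_eq`).
* The posterior error is the prior error under the same operator, whose norm is at most the square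
  of the largest `ℓ¹` norm `1 + ‖ξ(x)‖₁` of the coefficients (`IsGP.posteriorError_le`).
* Only the prior error of random Fourier features is therefore left to be estimated.

For the latter, the covariance of the model for given features is an empirical mean of i.i.d. random
functions `Z(ω_j, ·)` on `X × X`, and `k` is their expectation. The rate `l ^ (-1 / 2)` is a uniform
law of large numbers, `exists_uniform_law_const`. Since only a moment of small order `α` of the
frequencies is at hand, the increments of `Z` have no high moments that are small, and a moment
bound for the sums themselves does not suffice. Instead the sum is symmetrized
(`lintegral_iSup_sub_mean_le`, `two_pow_mul_lintegral_iSup_eq`), and chaining is applied to the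
random signs for fixed frequencies (`exists_chaining_const`). Given the frequencies, the signed sum
is sub-Gaussian for the metric `(∑ j, L(ω_j) ^ 2) ^ (1 / 2) * dist s t ^ β`, where `L(ω)` is a Hölder
constant of `Z(ω, ·)` of exponent `β = min 1 (α / 2)`; so its expected supremum is at most
`C * (∑ j, L(ω_j) ^ 2) ^ (1 / 2)`, and `L` is square integrable as it grows like `‖ω‖ ^ β`.
-/

namespace PathwiseGP

open scoped RealInnerProductSpace

/-! ### Chaining for signed sums -/

/-- The sign `±1` encoded by a Boolean. -/
def sgn (b : Bool) : ℝ := bif b then 1 else -1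

/-- Independence of the signs, together with `cosh b ≤ exp (b ^ 2 / 2)`, makes the signed sum
sub-Gaussian. -/
lemma sum_exp_signed_le {l : ℕ} (b : Fin l → ℝ) :
    ∑ ε : Fin l → Bool, Real.exp (∑ j, sgn (ε j) * b j) ≤
      2 ^ l * Real.exp ((∑ j, b j ^ 2) / 2) := by
  have h1 : ∑ ε : Fin l → Bool, Real.exp (∑ j, sgn (ε j) * b j) =
      ∏ j, (2 * Real.cosh (b j)) := by
    have : ∀ j, 2 * Real.cosh (b j) = ∑ s : Bool, Real.exp (sgn s * b j) := by
      intro j; simp [sgn, Real.cosh_eq]; ring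
    simp_rw [this, Finset.prod_univ_sum, Real.exp_sum, Fintype.piFinset_univ]
  rw [h1, Finset.prod_mul_distrib, Finset.sum_div, Real.exp_sum]
  simp only [Finset.prod_const, Finset.card_univ, Fintype.card_fin]
  gcongr with j
  exact Real.cosh_le_exp_half_sq _

lemma sum_cosh_signed_le {l : ℕ} (b : Fin l → ℝ) :
    ∑ ε : Fin l → Bool, 2 * Real.cosh (∑ j, sgn (ε j) * b j) ≤
      2 ^ l * (2 * Real.exp ((∑ j, b j ^ 2) / 2)) := by
  have h1 := sum_exp_signed_le b
  have h2 := sum_exp_signed_le (fun j => - b j)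
  simp only [mul_neg, Finset.sum_neg_distrib, neg_sq] at h2
  have : ∀ x : ℝ, 2 * Real.cosh x = Real.exp x + Real.exp (-x) := by
    intro x; rw [Real.cosh_eq]; ring
  simp_rw [this, Finset.sum_add_distrib]
  linarith

/-- A substitute for the union bound: the maximum of the `|x i|`, `i ∈ I`, is controlled by a sum of
exponentials whose weight `exp (-s)` can absorb the cardinality of `I`. -/
lemma abs_le_of_mem_sum_cosh {I : Type*} (T : Finset I) (x : I → ℝ) {c : ℝ} (hc : 0 < c) (s : ℝ)
    {i : I} (hi : i ∈ T) :
    |x i| ≤ c * (s + Real.exp (-s) * ∑ i ∈ T, 2 * Real.cosh (x i / c)) := by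
  have h1 : Real.exp (|x i| / c) ≤ ∑ i ∈ T, 2 * Real.cosh (x i / c) := by
    refine le_trans ?_ (Finset.single_le_sum (f := fun i => 2 * Real.cosh (x i / c))
      (fun j _ => by positivity) hi)
    have : Real.cosh (x i / c) = Real.cosh (|x i| / c) := by
      rw [← Real.cosh_abs (x i / c), abs_div, abs_of_pos hc]
    simp only [this, Real.cosh_eq]
    have := Real.exp_pos (-(|x i| / c))
    linarith
  have h2 : |x i| / c ≤ s + Real.exp (-s) * Real.exp (|x i| / c) := by
    rw [← Real.exp_add]
    have := Real.add_one_le_exp (-s + |x i| / c)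
    linarith
  have h3 : |x i| / c ≤ s + Real.exp (-s) * ∑ i ∈ T, 2 * Real.cosh (x i / c) :=
    h2.trans (by gcongr)
  rwa [div_le_iff₀' hc] at h3

/-- Nets of a ball in a finite-dimensional space at all dyadic scales, with cardinality growing
geometrically, and the projections `q m` onto them. -/
lemma exists_dyadic_nets (F : Type*) [NormedAddCommGroup F] [NormedSpace ℝ F] [ProperSpace F]
    {R : ℝ} (hR : 0 < R) :
    ∃ M : ℕ, 1 ≤ M ∧ ∃ (N : ℕ → Finset F) (q : ℕ → F → F),
      (∀ m, (N m).card ≤ M ^ m) ∧ (∀ m t, q m t ∈ N m) ∧ (∀ t, q 0 t = 0) ∧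
      ∀ m, ∀ t ∈ Metric.closedBall (0 : F) R, dist t (q m t) ≤ R / 2 ^ m := by
  classical
  -- half-size balls around finitely many centres cover the unit ball; the finer nets are sums of
  -- scaled copies of this one
  obtain ⟨B, p, hpB, hp⟩ : ∃ (B : Finset F) (p : F → F), (∀ v, p v ∈ B) ∧
      ∀ v, ‖v‖ ≤ 1 → ‖v - p v‖ ≤ 1 / 2 := by
    obtain ⟨B, -, hBf, hB⟩ := Metric.totallyBounded_iff.1
      (isCompact_closedBall (0 : F) 1).totallyBounded (1 / 2) (by norm_num) |>.imp
      fun B h => (⟨trivial, h.1, h.2⟩ : True ∧ _ ∧ _)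
    have hex : ∀ v : F, ∃ u ∈ B, ‖v‖ ≤ 1 → ‖v - u‖ ≤ 1 / 2 := by
      intro v
      by_cases hv : ‖v‖ ≤ 1
      · have := hB (show v ∈ Metric.closedBall (0 : F) 1 by simpa using hv)
        simp only [Set.mem_iUnion, Metric.mem_ball, dist_eq_norm] at this
        obtain ⟨u, hu, huv⟩ := this
        exact ⟨u, hu, fun _ => huv.le⟩
      · have := hB (show (0 : F) ∈ Metric.closedBall (0 : F) 1 by simp)
        simp only [Set.mem_iUnion] at this
        obtain ⟨u, hu, -⟩ := this
        exact ⟨u, hu, fun h => absurd h hv⟩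
    choose p hp1 hp2 using hex
    exact ⟨hBf.toFinset, p, fun v => by simpa using hp1 v, hp2⟩
  let N : ℕ → Finset F := fun m => Nat.rec {0}
    (fun m A => (A ×ˢ B).image fun z => z.1 + (R / 2 ^ m) • z.2) m
  let q : ℕ → F → F := fun m t => Nat.rec 0
    (fun m u => u + (R / 2 ^ m) • p ((R / 2 ^ m)⁻¹ • (t - u))) m
  refine ⟨B.card, Finset.card_pos.2 ⟨_, hpB 0⟩, N, q, ?_, ?_, fun t => rfl, ?_⟩
  · intro m
    induction m with
    | zero => simp [N]
    | succ m ih =>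
      refine Finset.card_image_le.trans ?_
      rw [Finset.card_product, pow_succ]
      exact Nat.mul_le_mul_right _ ih
  · intro m t
    induction m with
    | zero => simp [N, q]
    | succ m ih => exact Finset.mem_image.2 ⟨(q m t, _), Finset.mk_mem_product ih (hpB _), rfl⟩
  · intro m t ht
    induction m with
    | zero => simpa [q] using ht
    | succ m ih =>
      have hr : 0 < R / 2 ^ m := by positivity
      have e : t - q (m + 1) t = (R / 2 ^ m) •
          ((R / 2 ^ m)⁻¹ • (t - q m t) - p ((R / 2 ^ m)⁻¹ • (t - q m t))) := by
        rw [smul_sub, smul_inv_smul₀ hr.ne']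
        simp only [q]
        abel
      rw [dist_eq_norm] at ih ⊢
      rw [e, norm_smul, Real.norm_of_nonneg hr.le]
      calc _ ≤ R / 2 ^ m * (1 / 2) := by
            gcongr
            apply hp
            rw [norm_smul, norm_inv, Real.norm_of_nonneg hr.le, inv_mul_le_iff₀ hr]
            linarith
        _ = _ := by rw [pow_succ]; field_simp

/-- Hölder functions are continuous. -/
lemma continuous_of_abs_sub_le_rpow {F : Type*} [PseudoMetricSpace F] {f : F → ℝ} {c β : ℝ}
    (hβ : 0 < β) (hf : ∀ s t, |f s - f t| ≤ c * dist s t ^ β) : Continuous f := by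
  rw [continuous_iff_continuousAt]
  intro t
  rw [ContinuousAt, tendsto_iff_dist_tendsto_zero]
  have h0 : Filter.Tendsto (fun s => c * dist s t ^ β) (nhds t) (nhds 0) := by
    have : Filter.Tendsto (fun s => c * dist s t ^ β) (nhds t) (nhds (c * dist t t ^ β)) :=
      (continuous_const.mul ((continuous_id.dist continuous_const).rpow_const
        fun _ => Or.inr hβ.le)).tendsto t
    simpa [Real.zero_rpow hβ.ne'] using this
  exact squeeze_zero (fun _ => dist_nonneg) (fun s => hf s t) h0

/-- A continuous function at `t` is recovered from the increments along a chain `q m t → t`. -/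
lemma enorm_le_add_tsum_of_chain {F : Type*} [TopologicalSpace F] {S : F → ℝ} {t : F}
    (hS : ContinuousAt S t) {q : ℕ → F} (hq : Filter.Tendsto q Filter.atTop (nhds t))
    {V : ℕ → ℝ≥0∞} (hV : ∀ m, ‖S (q (m + 1)) - S (q m)‖ₑ ≤ V m) :
    ‖S t‖ₑ ≤ ‖S (q 0)‖ₑ + ∑' m, V m := by
  have h : ∀ m, ‖S (q m)‖ₑ ≤ ‖S (q 0)‖ₑ + ∑ i ∈ Finset.range m, V i := by
    intro m
    induction m with
    | zero => simp
    | succ m ih =>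
      calc ‖S (q (m + 1))‖ₑ = ‖S (q m) + (S (q (m + 1)) - S (q m))‖ₑ := by congr 1; ring
        _ ≤ ‖S (q m)‖ₑ + ‖S (q (m + 1)) - S (q m)‖ₑ := enorm_add_le _ _
        _ ≤ _ := by
          rw [Finset.sum_range_succ, ← add_assoc]
          exact add_le_add ih (hV m)
  refine le_of_tendsto ((continuous_enorm.continuousAt.comp hS).tendsto.comp hq) ?_
  exact Filter.Eventually.of_forall fun m => (h m).trans (by gcongr; exact ENNReal.sum_le_tsum _)

/-- **Chaining.** Averaged over the signs, the supremum over a ball of a signed sum of Hölder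
functions is at most a constant times the `ℓ²` norm of their Hölder constants. The point is that the
constant depends neither on the functions nor on their number. -/
theorem exists_chaining_const (F : Type*) [NormedAddCommGroup F] [NormedSpace ℝ F] [ProperSpace F]
    {R : ℝ} (hR : 0 < R) {β : ℝ} (hβ : 0 < β) :
    ∃ C : ℝ, 0 ≤ C ∧ ∀ (l : ℕ) (a : Fin l → F → ℝ) (L : Fin l → ℝ) (σ : ℝ), 0 < σ →
      (∀ j s t, |a j s - a j t| ≤ L j * dist s t ^ β) → (∀ j, |a j 0| ≤ L j) →
      ∑ j, L j ^ 2 ≤ σ ^ 2 →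
      ∑ ε : Fin l → Bool, ⨆ t ∈ Metric.closedBall (0 : F) R, ‖∑ j, sgn (ε j) * a j t‖ₑ ≤
        2 ^ l * ENNReal.ofReal (C * σ) := by
  classical
  obtain ⟨M, hM, N, q, hN, hqN, hq0, hq⟩ := exists_dyadic_nets F hR
  have hM0 : (0 : ℝ) < M := by exact_mod_cast hM
  -- consecutive points of a chain are at distance at most `2R / 2 ^ m`; there are at most
  -- `exp (s m)` such pairs
  let δ : ℕ → ℝ := fun m => (2 * R / 2 ^ m) ^ β
  let s : ℕ → ℝ := fun m => (2 * m + 1) * Real.log M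
  let E : ℝ := 2 * Real.exp (1 / 2)
  have hδ : ∀ m, 0 < δ m := fun m => by positivity
  have hs : ∀ m, 0 ≤ s m := fun m => by
    have := Real.log_nonneg (show (1 : ℝ) ≤ M by exact_mod_cast hM)
    positivity
  have hes : ∀ m, Real.exp (-s m) * (M : ℝ) ^ (2 * m + 1) = 1 := by
    intro m
    rw [show (M : ℝ) ^ (2 * m + 1) = Real.exp (s m) by
      rw [← Real.rpow_natCast, Real.rpow_def_of_pos hM0, mul_comm]; push_cast; rfl]
    rw [← Real.exp_add]; simp
  have hsum : Summable fun m => δ m * (s m + E) := by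
    let r : ℝ := (1 / 2) ^ β
    have hr0 : 0 < r := by positivity
    have hr : ‖r‖ < 1 := by
      rw [Real.norm_of_nonneg hr0.le]
      exact Real.rpow_lt_one (by norm_num) (by norm_num) hβ
    have hδ' : ∀ m, δ m = (2 * R) ^ β * r ^ m := by
      intro m
      simp only [δ, r]
      rw [← Real.rpow_natCast ((1 / 2 : ℝ) ^ β), ← Real.rpow_mul (by norm_num), mul_comm β,
        Real.rpow_mul (by norm_num), Real.rpow_natCast, ← Real.mul_rpow (by positivity)
        (by positivity)]
      congr 1
      rw [one_div, inv_pow]; rfl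
    have h1 := (summable_pow_mul_geometric_of_norm_lt_one 1 hr).mul_left
      ((2 * R) ^ β * (2 * Real.log M))
    have h2 := (summable_geometric_of_norm_lt_one hr).mul_left ((2 * R) ^ β * (Real.log M + E))
    refine (h1.add h2).congr fun m => ?_
    rw [hδ' m]; simp only [s]; ring
  have hterm : ∀ m, 0 ≤ δ m * (s m + E) := fun m =>
    mul_nonneg (hδ m).le (add_nonneg (hs m) (by positivity))
  refine ⟨E + ∑' m, δ m * (s m + E), add_nonneg (by positivity) (tsum_nonneg hterm), ?_⟩
  intro l a L σ hσ ha ha0 hL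
  let S : (Fin l → Bool) → F → ℝ := fun ε t => ∑ j, sgn (ε j) * a j t
  let T : ℕ → Finset (F × F) := fun m =>
    (N m ×ˢ N (m + 1)).filter fun z => dist z.2 z.1 ≤ 2 * R / 2 ^ m
  let V : ℕ → (Fin l → Bool) → ℝ := fun m ε => σ * δ m * (s m + Real.exp (-s m) *
    ∑ z ∈ T m, 2 * Real.cosh ((S ε z.2 - S ε z.1) / (σ * δ m)))
  let V0 : (Fin l → Bool) → ℝ := fun ε => σ * (2 * Real.cosh (S ε 0 / σ))
  have hV0n : ∀ ε, 0 ≤ V0 ε := fun ε => by positivity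
  have hVn : ∀ m ε, 0 ≤ V m ε := fun m ε => mul_nonneg (mul_nonneg hσ.le (hδ m).le)
    (add_nonneg (hs m) (mul_nonneg (Real.exp_pos _).le
      (Finset.sum_nonneg fun _ _ => by positivity)))
  have hT : ∀ m, ((T m).card : ℝ) ≤ (M : ℝ) ^ (2 * m + 1) := by
    intro m
    have : (T m).card ≤ M ^ (2 * m + 1) := by
      refine (Finset.card_filter_le _ _).trans ?_
      rw [Finset.card_product, show 2 * m + 1 = m + (m + 1) by ring, pow_add]
      exact Nat.mul_le_mul (hN m) (hN (m + 1))
    exact_mod_cast this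
  have hScont : ∀ ε, Continuous (S ε) := by
    intro ε
    exact continuous_finsetSum _ fun j _ =>
      continuous_const.mul (continuous_of_abs_sub_le_rpow hβ (ha j))
  -- the average over the signs of each link of the chain
  have hVsum : ∀ m, ∑ ε, V m ε ≤ 2 ^ l * (σ * (δ m * (s m + E))) := by
    intro m
    have hc : 0 < σ * δ m := mul_pos hσ (hδ m)
    have hz : ∀ z ∈ T m, ∑ ε, 2 * Real.cosh ((S ε z.2 - S ε z.1) / (σ * δ m)) ≤ 2 ^ l * E := by
      intro z hz
      have e : ∀ ε, (S ε z.2 - S ε z.1) / (σ * δ m) =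
          ∑ j, sgn (ε j) * ((a j z.2 - a j z.1) / (σ * δ m)) := by
        intro ε
        simp only [S]
        rw [← Finset.sum_sub_distrib, Finset.sum_div]
        exact Finset.sum_congr rfl fun j _ => by ring
      simp_rw [e]
      refine (sum_cosh_signed_le _).trans ?_
      have : ∑ j, ((a j z.2 - a j z.1) / (σ * δ m)) ^ 2 ≤ 1 := by
        simp_rw [div_pow]
        rw [← Finset.sum_div, div_le_one (by positivity), mul_pow]
        calc ∑ j, (a j z.2 - a j z.1) ^ 2 ≤ ∑ j, L j ^ 2 * δ m ^ 2 := by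
              refine Finset.sum_le_sum fun j _ => ?_
              rw [← mul_pow, ← sq_abs]
              have hL0 : 0 ≤ L j := (abs_nonneg _).trans (ha0 j)
              have hd : dist z.2 z.1 ≤ 2 * R / 2 ^ m := (Finset.mem_filter.1 hz).2
              refine pow_le_pow_left₀ (abs_nonneg _) ((ha j _ _).trans ?_) 2
              exact mul_le_mul_of_nonneg_left (Real.rpow_le_rpow dist_nonneg hd hβ.le) hL0
          _ ≤ σ ^ 2 * δ m ^ 2 := by rw [← Finset.sum_mul]; gcongr
      simp only [E]
      gcongr
    calc ∑ ε, V m ε = σ * δ m * (2 ^ l * s m + Real.exp (-s m) *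
          ∑ z ∈ T m, ∑ ε, 2 * Real.cosh ((S ε z.2 - S ε z.1) / (σ * δ m))) := by
          simp only [V]
          rw [← Finset.mul_sum, Finset.sum_add_distrib, Finset.sum_const,
            Finset.sum_comm (s := T m), ← Finset.mul_sum, nsmul_eq_mul]
          simp
      _ ≤ σ * δ m * (2 ^ l * s m + Real.exp (-s m) * ∑ z ∈ T m, 2 ^ l * E) := by
          gcongr with z hz'
          exact hz z hz'
      _ = σ * δ m * (2 ^ l * s m + Real.exp (-s m) * (T m).card * (2 ^ l * E)) := by
          rw [Finset.sum_const, nsmul_eq_mul]; ring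
      _ ≤ σ * δ m * (2 ^ l * s m + Real.exp (-s m) * (M : ℝ) ^ (2 * m + 1) * (2 ^ l * E)) := by
          have hE : 0 ≤ E := by positivity
          gcongr
          exact hT m
      _ = _ := by rw [hes]; ring
  have hV0sum : ∑ ε, V0 ε ≤ 2 ^ l * (σ * E) := by
    simp only [V0]
    rw [← Finset.mul_sum]
    have e : ∀ ε, S ε 0 / σ = ∑ j, sgn (ε j) * (a j 0 / σ) := by
      intro ε
      simp only [S]
      rw [Finset.sum_div]
      exact Finset.sum_congr rfl fun j _ => by ring
    simp_rw [e]
    have h2 := sum_cosh_signed_le (fun j => a j 0 / σ)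
    have : ∑ j, (a j 0 / σ) ^ 2 ≤ 1 := by
      simp_rw [div_pow]
      rw [← Finset.sum_div, div_le_one (by positivity)]
      refine le_trans (Finset.sum_le_sum fun j _ => ?_) hL
      rw [← sq_abs]
      exact pow_le_pow_left₀ (abs_nonneg _) (ha0 j) 2
    calc _ ≤ σ * (2 ^ l * (2 * Real.exp ((∑ j, (a j 0 / σ) ^ 2) / 2))) := by gcongr
      _ ≤ σ * (2 ^ l * E) := by simp only [E]; gcongr
      _ = _ := by ring
  have hsup : ∀ ε, ⨆ t ∈ Metric.closedBall (0 : F) R, ‖S ε t‖ₑ ≤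
      ENNReal.ofReal (V0 ε) + ∑' m, ENNReal.ofReal (V m ε) := by
    intro ε
    refine iSup₂_le fun t ht => ?_
    have hqt : Filter.Tendsto (fun m => q m t) Filter.atTop (nhds t) := by
      rw [tendsto_iff_dist_tendsto_zero]
      refine squeeze_zero (fun _ => dist_nonneg) (fun m => (dist_comm _ _).trans_le (hq m t ht)) ?_
      have := (tendsto_pow_atTop_nhds_zero_of_lt_one (r := (1 / 2 : ℝ)) (by norm_num)
        (by norm_num)).const_mul R
      simpa [div_eq_mul_inv] using this
    refine (enorm_le_add_tsum_of_chain (hScont ε).continuousAt hqt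
      (V := fun m => ENNReal.ofReal (V m ε)) fun m => ?_).trans (add_le_add_left ?_ _)
    · rw [Real.enorm_eq_ofReal_abs]
      refine ENNReal.ofReal_le_ofReal ?_
      refine abs_le_of_mem_sum_cosh (T m) (fun z : F × F => S ε z.2 - S ε z.1)
        (mul_pos hσ (hδ m)) (s m) (i := (q m t, q (m + 1) t)) ?_
      refine Finset.mem_filter.2 ⟨Finset.mk_mem_product (hqN _ _) (hqN _ _), ?_⟩
      calc dist (q (m + 1) t) (q m t) ≤ dist (q (m + 1) t) t + dist t (q m t) :=
            dist_triangle _ _ _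
        _ ≤ R / 2 ^ m + R / 2 ^ m := by
          refine add_le_add ?_ (hq m t ht)
          rw [dist_comm]
          refine (hq (m + 1) t ht).trans ?_
          gcongr
          · norm_num
          · simp
        _ = _ := by ring
    · rw [hq0, Real.enorm_eq_ofReal_abs]
      refine ENNReal.ofReal_le_ofReal ?_
      simpa using abs_le_of_mem_sum_cosh {()} (fun _ => S ε 0) hσ 0 (Finset.mem_singleton_self ())
  calc ∑ ε : Fin l → Bool, ⨆ t ∈ Metric.closedBall (0 : F) R, ‖S ε t‖ₑ
      ≤ ∑ ε, (ENNReal.ofReal (V0 ε) + ∑' m, ENNReal.ofReal (V m ε)) :=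
        Finset.sum_le_sum fun ε _ => hsup ε
    _ = ENNReal.ofReal (∑ ε, V0 ε) + ∑' m, ENNReal.ofReal (∑ ε, V m ε) := by
        rw [Finset.sum_add_distrib, ENNReal.ofReal_sum_of_nonneg fun ε _ => hV0n ε,
          ← Summable.tsum_finsetSum fun _ _ => ENNReal.summable]
        congr 2
        ext m
        rw [ENNReal.ofReal_sum_of_nonneg fun ε _ => hVn m ε]
    _ ≤ ENNReal.ofReal (2 ^ l * (σ * E)) +
          ∑' m, ENNReal.ofReal (2 ^ l * (σ * (δ m * (s m + E)))) :=
        add_le_add (ENNReal.ofReal_le_ofReal hV0sum)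
          (ENNReal.tsum_le_tsum fun m => ENNReal.ofReal_le_ofReal (hVsum m))
    _ = 2 ^ l * ENNReal.ofReal ((E + ∑' m, δ m * (s m + E)) * σ) := by
        have hn : ∀ m, 0 ≤ (2 : ℝ) ^ l * (σ * (δ m * (s m + E))) := fun m =>
          mul_nonneg (by positivity) (mul_nonneg hσ.le (hterm m))
        rw [← ENNReal.ofReal_tsum_of_nonneg hn ((hsum.mul_left σ).mul_left _),
          ← ENNReal.ofReal_add (by positivity) (tsum_nonneg hn), tsum_mul_left, tsum_mul_left,
          ← mul_add, ENNReal.ofReal_mul (by positivity), ENNReal.ofReal_pow (by norm_num)]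
        congr 2
        · norm_num
        · ring

/-! ### Symmetrization and the uniform law of large numbers -/

section Symmetrization

variable {E F : Type*} [MeasurableSpace E] {ν : Measure E} [IsProbabilityMeasure ν]
  {Z : E → F → ℝ} {l : ℕ} {T : Set F}

/-- Replacing the mean by an independent copy of the sample. -/
lemma lintegral_iSup_sub_mean_le (hT : T.Countable) (hZ : ∀ t, Measurable fun e => Z e t)
    (hZi : ∀ t, Integrable (fun e => Z e t) ν) :
    ∫⁻ e, ⨆ t ∈ T, ‖∑ j, (Z (e j) t - ∫ e', Z e' t ∂ν)‖ₑ ∂Measure.pi (fun _ : Fin l => ν) ≤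
      ∫⁻ η, ⨆ t ∈ T, ‖∑ j, (Z (η j).1 t - Z (η j).2 t)‖ₑ
        ∂Measure.pi (fun _ : Fin l => ν.prod ν) := by
  have hpair : Measurable fun p : (Fin l → E) × (Fin l → E) =>
      ⨆ t ∈ T, ‖∑ j, (Z (p.1 j) t - Z (p.2 j) t)‖ₑ := by
    refine Measurable.biSup T hT fun t _ => ?_
    refine (Finset.measurable_sum _ fun j _ => ?_).enorm
    exact ((hZ t).comp ((measurable_pi_apply j).comp measurable_fst)).sub
      ((hZ t).comp ((measurable_pi_apply j).comp measurable_snd))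
  have hmp := measurePreserving_arrowProdEquivProdArrow E E (Fin l) (fun _ => ν) (fun _ => ν)
  have e1 := hmp.lintegral_comp hpair
  simp only [MeasurableEquiv.arrowProdEquivProdArrow, MeasurableEquiv.coe_mk,
    Equiv.arrowProdEquivProdArrow, Equiv.coe_fn_mk] at e1
  rw [e1, lintegral_prod _ hpair.aemeasurable]
  refine lintegral_mono fun e => iSup₂_le fun t ht => ?_
  have hint : ∀ j : Fin l, Integrable (fun e' : Fin l → E => Z (e' j) t)
      (Measure.pi fun _ => ν) := fun j =>
    (measurePreserving_eval (fun _ : Fin l => ν) j).integrable_comp_of_integrable (hZi t)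
  have e2 : ∑ j, (Z (e j) t - ∫ e', Z e' t ∂ν) =
      ∫ e', ∑ j, (Z (e j) t - Z (e' j) t) ∂Measure.pi (fun _ : Fin l => ν) := by
    rw [integral_finsetSum (f := fun (j : Fin l) (e' : Fin l → E) => Z (e j) t - Z (e' j) t) _
      fun j _ => (integrable_const _).sub (hint j)]
    refine Finset.sum_congr rfl fun j _ => ?_
    rw [integral_sub (integrable_const _) (hint j), integral_const]
    rw [integral_comp_eval (μ := fun _ : Fin l => ν) (i := j) (f := fun e => Z e t)
      (hZ t).aestronglyMeasurable]
    simp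
  rw [e2]
  refine (enorm_integral_le_lintegral_enorm _).trans (lintegral_mono fun e' => ?_)
  exact le_iSup₂ (f := fun t _ => ‖∑ j, (Z (e j) t - Z (e' j) t)‖ₑ) t ht

/-- Exchanging the two samples in some of the coordinates does not change their law, so that signs
may be inserted. -/
lemma two_pow_mul_lintegral_iSup_eq (hT : T.Countable) (hZ : ∀ t, Measurable fun e => Z e t) :
    2 ^ l * ∫⁻ η, ⨆ t ∈ T, ‖∑ j, (Z (η j).1 t - Z (η j).2 t)‖ₑ
        ∂Measure.pi (fun _ : Fin l => ν.prod ν) =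
      ∫⁻ η, ∑ ε : Fin l → Bool, ⨆ t ∈ T, ‖∑ j, sgn (ε j) * (Z (η j).1 t - Z (η j).2 t)‖ₑ
        ∂Measure.pi (fun _ : Fin l => ν.prod ν) := by
  have hm : ∀ ε : Fin l → Bool, Measurable fun η : Fin l → E × E =>
      ⨆ t ∈ T, ‖∑ j, sgn (ε j) * (Z (η j).1 t - Z (η j).2 t)‖ₑ := by
    intro ε
    refine Measurable.biSup T hT fun t _ => ?_
    refine (Finset.measurable_sum _ fun j _ => ?_).enorm
    exact (((hZ t).comp (measurable_fst.comp (measurable_pi_apply j))).sub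
      ((hZ t).comp (measurable_snd.comp (measurable_pi_apply j)))).const_mul _
  have hswap : ∀ ε : Fin l → Bool,
      ∫⁻ η, ⨆ t ∈ T, ‖∑ j, sgn (ε j) * (Z (η j).1 t - Z (η j).2 t)‖ₑ
        ∂Measure.pi (fun _ : Fin l => ν.prod ν) =
      ∫⁻ η, ⨆ t ∈ T, ‖∑ j, (Z (η j).1 t - Z (η j).2 t)‖ₑ
        ∂Measure.pi (fun _ : Fin l => ν.prod ν) := by
    intro ε
    have hmp : MeasurePreserving
        (fun (η : Fin l → E × E) j => (bif ε j then id else Prod.swap) (η j))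
        (Measure.pi fun _ => ν.prod ν) (Measure.pi fun _ => ν.prod ν) := by
      refine measurePreserving_pi (fun _ => ν.prod ν) (fun _ => ν.prod ν)
        (f := fun j => (bif ε j then id else Prod.swap)) fun j => ?_
      cases ε j
      · exact Measure.measurePreserving_swap
      · exact MeasurePreserving.id _
    have h1 := hm fun _ => true
    simp only [sgn, cond_true, one_mul] at h1
    rw [← hmp.lintegral_comp h1]
    refine lintegral_congr fun η => ?_
    refine iSup_congr fun t => iSup_congr fun _ => congrArg _ ?_
    refine Finset.sum_congr rfl fun j _ => ?_
    cases h : ε j <;> simp [sgn, h]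
  rw [lintegral_finsetSum _ fun ε _ => hm ε]
  simp_rw [hswap]
  simp

end Symmetrization

/-- The supremum of the norm of a continuous function over a set equals that over a dense subset. -/
lemma biSup_enorm_eq_of_dense {F G : Type*} [TopologicalSpace F] [NormedAddCommGroup G]
    {T' T : Set F} (hT' : T' ⊆ T) (hd : T ⊆ closure T') {h : F → G} (hh : Continuous h) :
    ⨆ t ∈ T, ‖h t‖ₑ = ⨆ t ∈ T', ‖h t‖ₑ := by
  refine le_antisymm (iSup₂_le fun t ht => ?_) (biSup_mono hT')
  have hc : IsClosed {t | ‖h t‖ₑ ≤ ⨆ t ∈ T', ‖h t‖ₑ} :=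
    isClosed_le hh.enorm continuous_const
  exact closure_minimal (fun s hs => le_iSup₂ (f := fun t (_ : t ∈ T') => ‖h t‖ₑ) s hs) hc (hd ht)

lemma exists_countable_dense_subset_of_set {F : Type*} [PseudoMetricSpace F]
    [SecondCountableTopology F] (T : Set F) :
    ∃ T' ⊆ T, T'.Countable ∧ T ⊆ closure T' := by
  obtain ⟨c, hc, hd⟩ :=
    (TopologicalSpace.IsSeparable.of_separableSpace T).exists_countable_dense_subset
  exact ⟨c, hc, hd⟩

lemma measurable_biSup_enorm {Ω F : Type*} [MeasurableSpace Ω] [PseudoMetricSpace F]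
    [SecondCountableTopology F] (T : Set F) {h : Ω → F → ℝ} (hc : ∀ p, Continuous (h p))
    (hm : ∀ t, Measurable fun p => h p t) : Measurable fun p => ⨆ t ∈ T, ‖h p t‖ₑ := by
  obtain ⟨T', hT'T, hT'c, hT'd⟩ := exists_countable_dense_subset_of_set T
  simp_rw [fun p => biSup_enorm_eq_of_dense hT'T hT'd (hc p)]
  exact Measurable.biSup T' hT'c fun t _ => (hm t).enorm

/-- **Uniform law of large numbers with rate.** For i.i.d. random Hölder functions `Z (e j)` on a
bounded subset of a finite-dimensional space, whose Hölder constant is square integrable, the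
expected supremum of the centred sum is of order `l ^ (1 / 2)`. -/
theorem exists_uniform_law_const (F : Type*) [NormedAddCommGroup F] [NormedSpace ℝ F]
    [ProperSpace F] {R : ℝ} (hR : 0 < R) {β : ℝ} (hβ : 0 < β) :
    ∃ C : ℝ, 0 ≤ C ∧ ∀ {E Ω : Type*} [MeasurableSpace E] [MeasurableSpace Ω] (ν : Measure E)
      [IsProbabilityMeasure ν] (P : Measure Ω) [IsProbabilityMeasure P]
      (Z : E → F → ℝ) (L : E → ℝ) (B : ℝ) (T : Set F) (l : ℕ) (e : Fin l → Ω → E), 1 ≤ l →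
      T ⊆ Metric.closedBall 0 R →
      (∀ t, Measurable fun e => Z e t) → (∀ e t, |Z e t| ≤ B) →
      Measurable L → (∀ e, 0 < L e) → (∀ e s t, |Z e s - Z e t| ≤ L e * dist s t ^ β) →
      (∀ e, |Z e 0| ≤ L e) → iIndepFun e P → (∀ j, HasLaw (e j) ν P) →
      ∫⁻ p, ⨆ t ∈ T, ‖∑ j, (Z (e j p) t - ∫ e', Z e' t ∂ν)‖ₑ ∂P ≤
        ENNReal.ofReal (C * √l) * (1 + 4 * ∫⁻ e, ENNReal.ofReal (L e ^ 2) ∂ν) := by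
  obtain ⟨C, hC, hmain⟩ := exists_chaining_const F hR hβ
  refine ⟨C, hC, ?_⟩
  intro E Ω _ _ ν _ P _ Z L B T l e hl hTR hZ hB hL hL0 hLip hZ0 hind hlaw
  have hZc : ∀ e, Continuous (Z e) := fun e => continuous_of_abs_sub_le_rpow hβ (hLip e)
  have hmc : Continuous fun t => ∫ e, Z e t ∂ν :=
    continuous_of_dominated (fun t => (hZ t).aestronglyMeasurable)
      (fun t => Filter.Eventually.of_forall fun e => hB e t) (integrable_const B)
      (Filter.Eventually.of_forall hZc)
  have hsc : ∀ e : Fin l → E, Continuous fun t => ∑ j, (Z (e j) t - ∫ e', Z e' t ∂ν) := fun e =>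
    continuous_finsetSum _ fun j _ => (hZc _).sub hmc
  have hGm : Measurable fun e : Fin l → E => ⨆ t ∈ T, ‖∑ j, (Z (e j) t - ∫ e', Z e' t ∂ν)‖ₑ :=
    measurable_biSup_enorm T hsc fun t => Finset.measurable_sum _ fun j _ =>
      ((hZ t).comp (measurable_pi_apply j)).sub_const _
  rw [(hind.hasLaw_pi hlaw).lintegral_comp hGm.aemeasurable]
  obtain ⟨T', hT'T, hT'c, hT'd⟩ := exists_countable_dense_subset_of_set T
  simp_rw [fun e => biSup_enorm_eq_of_dense hT'T hT'd (hsc e)]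
  have hZi : ∀ t, Integrable (fun e => Z e t) ν := fun t =>
    Integrable.of_bound (hZ t).aestronglyMeasurable B (Filter.Eventually.of_forall fun e => hB e t)
  refine (lintegral_iSup_sub_mean_le hT'c hZ hZi).trans ?_
  have hl0 : (0 : ℝ) < √l := Real.sqrt_pos.2 (by exact_mod_cast hl)
  let Q : (Fin l → E × E) → ℝ := fun η => ∑ j, (L (η j).1 + L (η j).2) ^ 2
  have hQ : ∀ η, 0 < Q η := fun η => Finset.sum_pos
    (fun j _ => pow_pos (add_pos (hL0 _) (hL0 _)) 2) ⟨⟨0, hl⟩, Finset.mem_univ _⟩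
  have hQint : ∫⁻ η, ENNReal.ofReal (Q η) ∂Measure.pi (fun _ : Fin l => ν.prod ν) ≤
      l * (4 * ∫⁻ e, ENNReal.ofReal (L e ^ 2) ∂ν) := by
    have hLm : Measurable fun e => ENNReal.ofReal (L e ^ 2) := (hL.pow_const 2).ennreal_ofReal
    have hb : ∀ η, ENNReal.ofReal (Q η) ≤ ∑ j, (2 * ENNReal.ofReal (L (η j).1 ^ 2) +
        2 * ENNReal.ofReal (L (η j).2 ^ 2)) := by
      intro η
      simp only [Q]
      rw [ENNReal.ofReal_sum_of_nonneg fun j _ => sq_nonneg _]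
      refine Finset.sum_le_sum fun j _ => ?_
      rw [show (2 : ℝ≥0∞) = ENNReal.ofReal 2 by norm_num, ← ENNReal.ofReal_mul (by norm_num),
        ← ENNReal.ofReal_mul (by norm_num), ← ENNReal.ofReal_add (by positivity) (by positivity)]
      refine ENNReal.ofReal_le_ofReal ?_
      nlinarith [sq_nonneg (L (η j).1 - L (η j).2)]
    refine (lintegral_mono hb).trans ?_
    have hpm : Measurable fun p : E × E =>
        2 * ENNReal.ofReal (L p.1 ^ 2) + 2 * ENNReal.ofReal (L p.2 ^ 2) :=
      ((hLm.comp measurable_fst).const_mul _).add ((hLm.comp measurable_snd).const_mul _)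
    rw [lintegral_finsetSum (f := fun (j : Fin l) (η : Fin l → E × E) =>
      2 * ENNReal.ofReal (L (η j).1 ^ 2) + 2 * ENNReal.ofReal (L (η j).2 ^ 2)) _
      fun j _ => hpm.comp (measurable_pi_apply j)]
    have : ∀ j : Fin l, ∫⁻ η, (2 * ENNReal.ofReal (L (η j).1 ^ 2) +
        2 * ENNReal.ofReal (L (η j).2 ^ 2)) ∂Measure.pi (fun _ : Fin l => ν.prod ν) =
        4 * ∫⁻ e, ENNReal.ofReal (L e ^ 2) ∂ν := by
      intro j
      rw [(measurePreserving_eval (fun _ : Fin l => ν.prod ν) j).lintegral_comp hpm,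
        lintegral_add_left (f := fun p : E × E => 2 * ENNReal.ofReal (L p.1 ^ 2))
          ((hLm.comp measurable_fst).const_mul _),
        (measurePreserving_fst (μ := ν) (ν := ν)).lintegral_comp (hLm.const_mul 2),
        (measurePreserving_snd (μ := ν) (ν := ν)).lintegral_comp (hLm.const_mul 2),
        lintegral_const_mul _ hLm, ← add_mul]
      norm_num
    simp [this]
  -- conditionally on the two samples, the signed sum is controlled by chaining
  have hcond : ∀ η : Fin l → E × E,
      ∑ ε : Fin l → Bool, ⨆ t ∈ T', ‖∑ j, sgn (ε j) * (Z (η j).1 t - Z (η j).2 t)‖ₑ ≤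
        2 ^ l * (ENNReal.ofReal (C * √l) *
          (1 + ENNReal.ofReal (Q η) * ENNReal.ofReal (l : ℝ)⁻¹)) := by
    intro η
    calc _ ≤ ∑ ε : Fin l → Bool, ⨆ t ∈ Metric.closedBall (0 : F) R,
          ‖∑ j, sgn (ε j) * (Z (η j).1 t - Z (η j).2 t)‖ₑ :=
          Finset.sum_le_sum fun ε _ => biSup_mono fun t ht => hTR (hT'T ht)
      _ ≤ 2 ^ l * ENNReal.ofReal (C * √(Q η)) := by
          refine hmain l (fun j t => Z (η j).1 t - Z (η j).2 t) (fun j => L (η j).1 + L (η j).2)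
            _ (Real.sqrt_pos.2 (hQ η)) (fun j s t => ?_) (fun j => ?_) (Real.sq_sqrt (hQ η).le).ge
          · have h1 := hLip (η j).1 s t
            have h2 := hLip (η j).2 s t
            rw [abs_le] at *
            constructor <;> linarith
          · have h1 := hZ0 (η j).1
            have h2 := hZ0 (η j).2
            rw [abs_le] at *
            constructor <;> linarith
      _ ≤ _ := by
          rw [← ENNReal.ofReal_mul (hQ η).le, ← ENNReal.ofReal_one,
            ← ENNReal.ofReal_add zero_le_one (mul_nonneg (hQ η).le (by positivity)),
            ← ENNReal.ofReal_mul (by positivity)]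
          refine mul_le_mul_right (ENNReal.ofReal_le_ofReal ?_) _
          rw [mul_assoc]
          refine mul_le_mul_of_nonneg_left ?_ hC
          -- `√Q ≤ √l + Q / √l` replaces the Cauchy–Schwarz inequality for the outer expectation
          have h1 : √(Q η) ^ 2 = Q η := Real.sq_sqrt (hQ η).le
          have h2 : √(l : ℝ) ^ 2 = l := Real.sq_sqrt (by positivity)
          have h3 : √(l : ℝ) * (1 + √(Q η) ^ 2 * (√(l : ℝ) ^ 2)⁻¹) =
              (√(l : ℝ) ^ 2 + √(Q η) ^ 2) / √(l : ℝ) := by field_simp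
          rw [h1, h2] at h3
          rw [h3, le_div_iff₀ hl0]
          nlinarith [sq_nonneg (√(Q η) - √(l : ℝ))]
  have hfin := (two_pow_mul_lintegral_iSup_eq (ν := ν) (l := l) hT'c hZ).trans_le
    (lintegral_mono hcond)
  rw [lintegral_const_mul' _ _ (by finiteness)] at hfin
  have h2 := (ENNReal.mul_le_mul_iff_right (by positivity) (by finiteness)).1 hfin
  refine h2.trans ?_
  rw [lintegral_const_mul' _ _ ENNReal.ofReal_ne_top, lintegral_add_left measurable_const,
    lintegral_mul_const' _ _ ENNReal.ofReal_ne_top]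
  simp only [lintegral_const, measure_univ, mul_one]
  refine mul_le_mul_right (add_le_add_right ?_ _) _
  refine (mul_le_mul_left hQint _).trans ?_
  rw [mul_right_comm, ← ENNReal.ofReal_natCast, ← ENNReal.ofReal_mul (by positivity),
    mul_inv_cancel₀ (by positivity)]
  simp

/-! ### Covariance of the pathwise update -/

/-- The coefficients of the pathwise update as a linear combination of values of the process: `1` at
the point `x` itself, which is indexed by `none`, and `-ξ_i(x)` at the `i`-th data point. -/
noncomputable def updateCoeff {X : Type*} {n : ℕ} (k : X → X → ℝ) (Xn : Fin n → X) (x : X) :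
    Option (Fin n) → ℝ :=
  fun o => o.elim 1 fun i => -weight k Xn x i

/-- The points at which the pathwise update at `x` evaluates the process: `x`, indexed by `none`,
and the data points. -/
def updatePoint {X : Type*} {n : ℕ} (Xn : Fin n → X) (x : X) : Option (Fin n) → X :=
  fun o => o.elim x Xn

lemma pathwise_eq_sum {X Ω 𝕜 : Type*} [RCLike 𝕜] {n : ℕ} (k : X → X → ℝ) (Xn : Fin n → X)
    (y : Fin n → ℝ) (g : X → Ω → 𝕜) (x : X) (ω : Ω) :
    pathwise k Xn y g x ω = ∑ o, (updateCoeff k Xn x o : 𝕜) * g (updatePoint Xn x o) ω +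
      ∑ i, ((weight k Xn x i : ℝ) : 𝕜) * ((y i : ℝ) : 𝕜) := by
  simp only [pathwise, Fintype.sum_option, updateCoeff, updatePoint, Option.elim, mul_sub,
    Finset.sum_sub_distrib, RCLike.ofReal_one, one_mul, RCLike.ofReal_neg, neg_mul,
    Finset.sum_neg_distrib]
  ring

section Covariance

variable {X Ω 𝕜 : Type*} [RCLike 𝕜] [MeasurableSpace Ω] {P : Measure Ω} [IsProbabilityMeasure P]
  {n : ℕ}

lemma covFun_add_const (g : X → Ω → 𝕜) (hg : ∀ x, Integrable (g x) P) (c : X → 𝕜) (x x' : X) :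
    covFun P (fun x ω => g x ω + c x) x x' = covFun P g x x' := by
  have h : ∀ x, ∫ ω, (g x ω + c x) ∂P = ∫ ω, g x ω ∂P + c x := by
    intro x
    rw [integral_add (hg x) (integrable_const _)]
    simp
  simp only [covFun, h, add_sub_add_right_eq_sub]

lemma covFun_sum {ι Y : Type*} [Fintype ι] (g : Y → Ω → 𝕜) (hg : ∀ x, MemLp (g x) 2 P)
    (c : X → ι → 𝕜) (p : X → ι → Y) (x x' : X) :
    covFun P (fun x ω => ∑ o, c x o * g (p x o) ω) x x' =
      ∑ o, ∑ o', c x o * (starRingEnd 𝕜) (c x' o') * covFun P g (p x o) (p x' o') := by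
  have hm : ∀ x, ∫ ω, ∑ o, c x o * g (p x o) ω ∂P = ∑ o, c x o * ∫ ω, g (p x o) ω ∂P := by
    intro x
    rw [integral_finsetSum (f := fun o ω => c x o * g (p x o) ω) _
      fun o _ => ((hg _).integrable one_le_two).const_mul _]
    simp_rw [integral_const_mul]
  have hc : ∀ x, MemLp (fun ω => g x ω - ∫ ω', g x ω' ∂P) 2 P := fun x =>
    (hg x).sub (memLp_const _)
  have hi : ∀ x x', Integrable (fun ω => (g x ω - ∫ ω', g x ω' ∂P) *
      (starRingEnd 𝕜) (g x' ω - ∫ ω', g x' ω' ∂P)) P := fun x x' =>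
    (hc x).integrable_mul (hc x').star
  simp only [covFun, hm, ← Finset.sum_sub_distrib, ← mul_sub, map_sum, Finset.sum_mul_sum, map_mul]
  have e : ∀ ω, ∑ o, ∑ o', c x o * (g (p x o) ω - ∫ ω, g (p x o) ω ∂P) *
      ((starRingEnd 𝕜) (c x' o') * (starRingEnd 𝕜) (g (p x' o') ω - ∫ ω, g (p x' o') ω ∂P)) =
      ∑ o, ∑ o', c x o * (starRingEnd 𝕜) (c x' o') * ((g (p x o) ω - ∫ ω, g (p x o) ω ∂P) *
        (starRingEnd 𝕜) (g (p x' o') ω - ∫ ω, g (p x' o') ω ∂P)) := fun ω =>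
    Finset.sum_congr rfl fun o _ => Finset.sum_congr rfl fun o' _ => by ring
  simp_rw [e]
  rw [integral_finsetSum _ fun o _ => integrable_finsetSum _ fun o' _ => (hi _ _).const_mul _]
  refine Finset.sum_congr rfl fun o _ => ?_
  rw [integral_finsetSum _ fun o' _ => (hi _ _).const_mul _]
  simp_rw [integral_const_mul]

/-- The pathwise update acts on covariance functions by a linear operator. -/
lemma covFun_pathwise (k : X → X → ℝ) (Xn : Fin n → X) (y : Fin n → ℝ) (g : X → Ω → 𝕜)
    (hg : ∀ x, MemLp (g x) 2 P) (x x' : X) :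
    covFun P (pathwise k Xn y g) x x' =
      ∑ o, ∑ o', ((updateCoeff k Xn x o * updateCoeff k Xn x' o' : ℝ) : 𝕜) *
        covFun P g (updatePoint Xn x o) (updatePoint Xn x' o') := by
  have e : pathwise k Xn y g = fun x ω =>
      ∑ o, (updateCoeff k Xn x o : 𝕜) * g (updatePoint Xn x o) ω +
        ∑ i, ((weight k Xn x i : ℝ) : 𝕜) * ((y i : ℝ) : 𝕜) := by
    ext x ω; exact pathwise_eq_sum k Xn y g x ω
  rw [e, covFun_add_const (fun x ω => ∑ o, (updateCoeff k Xn x o : 𝕜) * g (updatePoint Xn x o) ω)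
    fun x => integrable_finsetSum _ fun o _ => ((hg _).integrable one_le_two).const_mul _,
    covFun_sum g hg (fun x o => (updateCoeff k Xn x o : 𝕜)) fun x => updatePoint Xn x]
  simp

end Covariance

lemma le_supNorm {X E : Type*} [NormedAddCommGroup E] (c : X → X → E) (x x' : X) :
    ‖c x x'‖ₑ ≤ supNorm c :=
  le_iSup_of_le x (le_iSup (fun x' => ‖c x x'‖ₑ) x')

/-- The residual `f(x) - ξ(x)ᵀ f(X_n)` of the linear prediction of `f(x)` from the data. -/
noncomputable def residual {X Ω : Type*} {n : ℕ} (k : X → X → ℝ) (Xn : Fin n → X)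
    (f : X → Ω → ℝ) (x : X) (ω : Ω) : ℝ :=
  ∑ o, updateCoeff k Xn x o * f (updatePoint Xn x o) ω

lemma residual_eq_sub {X Ω : Type*} {n : ℕ} {k : X → X → ℝ} {f : X → Ω → ℝ} (Xn : Fin n → X)
    (x : X) (ω : Ω) :
    residual k Xn f x ω = f x ω - ∑ i, weight k Xn x i * f (Xn i) ω := by
  simp [residual, updateCoeff, updatePoint, Fintype.sum_option, sub_eq_add_neg]

section GaussianProcess

variable {X Ω : Type*} [MeasurableSpace Ω] {P : Measure Ω} {f : X → Ω → ℝ} {μ : X → ℝ}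
  {k : X → X → ℝ} {n : ℕ}

lemma IsGP.memLp_two (hf : IsGP P f μ k) (x : X) : MemLp (f x) 2 P :=
  (hf.gaussian.hasGaussianLaw_eval x).memLp_two

lemma IsGP.covFun_eq (hf : IsGP P f μ k) (x x' : X) : covFun P f x x' = k x x' := by
  rw [← hf.cov_eq, covariance]
  simp [covFun]

lemma IsGP.symm (hf : IsGP P f μ k) (x x' : X) : k x x' = k x' x := by
  rw [← hf.cov_eq, ← hf.cov_eq, covariance_comm]

lemma IsGP.memLp_residual (hf : IsGP P f μ k) (Xn : Fin n → X) (x : X) :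
    MemLp (residual k Xn f x) 2 P :=
  memLp_finsetSum _ fun _ _ => (hf.memLp_two _).const_mul _

/-- The residuals are uncorrelated with the data: this is the linear system
`K_{n,n} ξ(x) = k(X_n, x)`. -/
lemma IsGP.covariance_residual (hf : IsGP P f μ k) (Xn : Fin n → X)
    (hK : IsUnit (gram k Xn).det) (x : X) (j : Fin n) :
    cov[residual k Xn f x, f (Xn j); P] = 0 := by
  have := hf.gaussian.isProbabilityMeasure
  have h1 : residual k Xn f x = fun ω => f x ω - ∑ i, weight k Xn x i * f (Xn i) ω := by
    ext ω; exact residual_eq_sub Xn x ω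
  have h2 : ∑ i, weight k Xn x i * k (Xn i) (Xn j) = k x (Xn j) := by
    have : (gram k Xn).mulVec (weight k Xn x) j = k (Xn j) x := by
      rw [weight, Matrix.mulVec_mulVec, Matrix.mul_nonsing_inv _ hK, Matrix.one_mulVec]
    rw [hf.symm x, ← this]
    refine Finset.sum_congr rfl fun i _ => ?_
    rw [mul_comm, hf.symm (Xn i)]
    rfl
  rw [h1, covariance_fun_sub_left (hf.memLp_two x)
    (memLp_finsetSum _ fun i _ => (hf.memLp_two _).const_mul _) (hf.memLp_two _),
    covariance_fun_sum_left (fun i => (hf.memLp_two _).const_mul _) (hf.memLp_two _)]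
  simp_rw [covariance_const_mul_left, hf.cov_eq, h2, sub_self]

/-- Uncorrelated jointly Gaussian families are independent. -/
lemma IsGP.indepFun_residual (hf : IsGP P f μ k) (Xn : Fin n → X)
    (hK : IsUnit (gram k Xn).det) :
    IndepFun (fun ω x => residual k Xn f x ω) (fun ω i => f (Xn i) ω) P := by
  classical
  refine IsGaussianProcess.indepFun_of_covariance_eq_zero ?_
    (fun x => (hf.memLp_residual Xn x).aestronglyMeasurable.aemeasurable)
    (fun i => (hf.measurable _).aemeasurable) (fun x j => hf.covariance_residual Xn hK x j)
  refine hf.gaussian.of_isGaussianProcess fun s => ?_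
  cases s with
  | inl x =>
    refine ⟨Finset.univ.image (updatePoint Xn x), ∑ o, updateCoeff k Xn x o •
      ContinuousLinearMap.proj (R := ℝ) (φ := fun _ => ℝ) (⟨updatePoint Xn x o,
        Finset.mem_image_of_mem _ (Finset.mem_univ o)⟩ :
          {z // z ∈ Finset.univ.image (updatePoint Xn x)}), fun ω => ?_⟩
    simp [residual]
  | inr i =>
    exact ⟨{Xn i}, ContinuousLinearMap.proj (R := ℝ) (φ := fun _ => ℝ)
      (⟨Xn i, Finset.mem_singleton_self _⟩ : {z // z ∈ ({Xn i} : Finset X)}), fun ω => by simp⟩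

/-- The covariance function of the pathwise update is the conditional covariance: conditioning on
the data replaces `f(x)` by a function of the data plus the independent residual. -/
theorem IsGP.condCov_ae_eq (hf : IsGP P f μ k) (Xn : Fin n → X) (y : Fin n → ℝ)
    (hK : IsUnit (gram k Xn).det) (x x' : X) :
    condCov P f Xn x x' =ᵐ[P] fun _ => covFun P (pathwise k Xn y f) x x' := by
  have := hf.gaussian.isProbabilityMeasure
  have hcov : covFun P (pathwise k Xn y f) x x' = covFun P (residual k Xn f) x x' := by
    rw [← covFun_add_const (residual k Xn f)
      (fun x => (hf.memLp_residual Xn x).integrable one_le_two)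
      fun x => ∑ i, weight k Xn x i * y i]
    congr 1
    ext x ω
    simpa [residual] using pathwise_eq_sum k Xn y f x ω
  rw [hcov]
  have hmeasR : ∀ x, Measurable (residual k Xn f x) := fun x =>
    Finset.measurable_sum _ fun o _ => (hf.measurable _).const_mul _
  have hmeasD : Measurable fun ω i => f (Xn i) ω := measurable_pi_lambda _ fun i => hf.measurable _
  have hle : MeasurableSpace.comap (fun ω i => f (Xn i) ω) inferInstance ≤ ‹MeasurableSpace Ω› :=
    hmeasD.comap_le
  have hle' : MeasurableSpace.comap (fun ω x => residual k Xn f x ω) inferInstance ≤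
      ‹MeasurableSpace Ω› := (measurable_pi_lambda _ hmeasR).comap_le
  have hind := (IndepFun_iff_Indep _ _ _).1 (hf.indepFun_residual Xn hK)
  have hR : ∀ x, Measurable[MeasurableSpace.comap (fun ω x => residual k Xn f x ω) inferInstance]
      (residual k Xn f x) := fun x =>
    (measurable_pi_apply x).comp (comap_measurable (fun ω x => residual k Xn f x ω))
  have hpred : ∀ x, StronglyMeasurable[MeasurableSpace.comap (fun ω i => f (Xn i) ω) inferInstance]
      fun ω => ∑ i, weight k Xn x i * f (Xn i) ω := by
    intro x
    refine Measurable.stronglyMeasurable ?_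
    refine Finset.measurable_sum _ fun i _ => Measurable.const_mul ?_ _
    exact (measurable_pi_apply i).comp (comap_measurable (fun ω i => f (Xn i) ω))
  have hpredi : ∀ x, Integrable (fun ω => ∑ i, weight k Xn x i * f (Xn i) ω) P := fun x =>
    integrable_finsetSum _ fun i _ => ((hf.memLp_two _).integrable one_le_two).const_mul _
  have hcond : ∀ x, P[f x | MeasurableSpace.comap (fun ω i => f (Xn i) ω) inferInstance] =ᵐ[P]
      fun ω => P[residual k Xn f x] + ∑ i, weight k Xn x i * f (Xn i) ω := by
    intro x
    have e : f x = residual k Xn f x + fun ω => ∑ i, weight k Xn x i * f (Xn i) ω := by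
      ext ω; simp [residual_eq_sub]
    have h1 := condExp_add ((hf.memLp_residual Xn x).integrable one_le_two) (hpredi x)
      (MeasurableSpace.comap (fun ω i => f (Xn i) ω) inferInstance)
    have h2 := condExp_indep_eq hle' hle (hR x).stronglyMeasurable hind
    rw [condExp_of_stronglyMeasurable hle (hpred x) (hpredi x)] at h1
    rw [← e] at h1
    filter_upwards [h1, h2] with ω h1 h2
    rw [h1, Pi.add_apply, h2]
  have hprod : (fun ω => (f x ω -
        (P[f x | MeasurableSpace.comap (fun ω i => f (Xn i) ω) inferInstance]) ω) *
      (f x' ω - (P[f x' | MeasurableSpace.comap (fun ω i => f (Xn i) ω) inferInstance]) ω)) =ᵐ[P]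
      fun ω => (residual k Xn f x ω - P[residual k Xn f x]) *
        (residual k Xn f x' ω - P[residual k Xn f x']) := by
    filter_upwards [hcond x, hcond x'] with ω h1 h2
    rw [h1, h2, residual_eq_sub, residual_eq_sub]
    ring
  refine (condExp_congr_ae hprod).trans ?_
  refine (condExp_indep_eq hle' hle ?_ hind).trans ?_
  · exact (((hR x).sub_const _).mul ((hR x').sub_const _)).stronglyMeasurable
  · exact Filter.Eventually.of_forall fun ω => by simp [covFun]

end GaussianProcess

/-! ### From the prior error to the posterior error -/

lemma sum_abs_mulVec_le {n : ℕ} (A : Matrix (Fin n) (Fin n) ℝ) (v : Fin n → ℝ) {b : ℝ}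
    (hb : 0 ≤ b) (hv : ∀ i, |v i| ≤ b) : ∑ i, |A.mulVec v i| ≤ opNormInftyOne A * b := by
  have h := ContinuousLinearMap.le_opNorm (LinearMap.toContinuousLinearMap
    (((WithLp.linearEquiv 1 ℝ (Fin n → ℝ)).symm : (Fin n → ℝ) →ₗ[ℝ] PiLp 1 fun _ : Fin n => ℝ) ∘ₗ
      Matrix.toLin' A)) v
  rw [PiLp.norm_eq_of_L1] at h
  have hv' : ‖v‖ ≤ b := (pi_norm_le_iff_of_nonneg hb).2 hv
  refine le_trans h (mul_le_mul_of_nonneg_left hv' (norm_nonneg _))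

lemma opNormInftyOne_nonneg {n : ℕ} (A : Matrix (Fin n) (Fin n) ℝ) : 0 ≤ opNormInftyOne A :=
  norm_nonneg _

lemma constTwo_nonneg {X : Type*} {n : ℕ} (k : X → X → ℝ) (Xn : Fin n → X) :
    0 ≤ constTwo k Xn := by
  rw [constTwo]; positivity

/-- The factor `1 + ‖K_{n,n}⁻¹‖ ‖k‖` of `constTwo` bounds the `ℓ¹` norm of the coefficients. -/
lemma sum_abs_updateCoeff_le {X : Type*} {n : ℕ} {k : X → X → ℝ} (hk : supNorm k ≠ ∞)
    (Xn : Fin n → X) (x : X) :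
    ∑ o, |updateCoeff k Xn x o| ≤
      1 + opNormInftyOne (gram k Xn)⁻¹ * (supNorm k).toReal := by
  rw [Fintype.sum_option]
  simp only [updateCoeff, Option.elim, abs_one, abs_neg]
  gcongr
  refine sum_abs_mulVec_le _ _ ENNReal.toReal_nonneg fun i => ?_
  have := ENNReal.toReal_mono hk (le_supNorm k (Xn i) x)
  rwa [toReal_enorm] at this

/-- A stationary covariance function is bounded by `κ 0`, so that the supremum norm in `constTwo` is
not a junk value. -/
lemma IsGP.supNorm_statKernel_ne_top {d : ℕ} {X : Set (EuclideanSpace ℝ (Fin d))}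
    {κ : EuclideanSpace ℝ (Fin d) → ℝ} {Ω : Type*} [MeasurableSpace Ω] {P : Measure Ω}
    {f : X → Ω → ℝ} {μ : X → ℝ} (hf : IsGP P f μ (statKernel X κ)) :
    supNorm (statKernel X κ) ≠ ∞ := by
  have := hf.gaussian.isProbabilityMeasure
  refine ne_top_of_le_ne_top (ENNReal.ofReal_ne_top (r := κ 0)) ?_
  refine iSup_le fun x => iSup_le fun x' => ?_
  rw [Real.enorm_eq_ofReal_abs]
  refine ENNReal.ofReal_le_ofReal ?_
  have hvar : ∀ x, Var[f x; P] = κ 0 := by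
    intro x
    rw [← covariance_self (hf.measurable x).aemeasurable, hf.cov_eq]
    simp [statKernel]
  have h1 := variance_nonneg (f x + f x') P
  have h2 := variance_nonneg (f x - f x') P
  rw [variance_add (hf.memLp_two x) (hf.memLp_two x'), hvar, hvar, hf.cov_eq] at h1
  rw [variance_sub (hf.memLp_two x) (hf.memLp_two x'), hvar, hvar, hf.cov_eq] at h2
  rw [abs_le]
  constructor <;> linarith

/-- The error of the posterior covariance is the image of the error of the prior covariance under
the linear operator of `covFun_pathwise`, whose norm is bounded through the `ℓ¹` norm of the
coefficients. -/
theorem IsGP.posteriorError_le {X Ω Ω' 𝕜 : Type*} [RCLike 𝕜] [MeasurableSpace Ω]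
    [MeasurableSpace Ω'] {P : Measure Ω} {Pw : Measure Ω'} [IsProbabilityMeasure Pw]
    {f : X → Ω → ℝ} {μ : X → ℝ} {k : X → X → ℝ} (hf : IsGP P f μ k) (hk : supNorm k ≠ ∞)
    {n : ℕ} (hn : 1 ≤ n) (Xn : Fin n → X) (y : Fin n → ℝ) (g : X → Ω' → 𝕜)
    (hg : ∀ x, MemLp (g x) 2 Pw) :
    posteriorError k Xn y P f Pw g ≤
      ENNReal.ofReal (constTwo k Xn) * priorError k Pw g := by
  have := hf.gaussian.isProbabilityMeasure
  refine iSup_le fun x => iSup_le fun x' => ?_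
  have e : covFun Pw (pathwise k Xn y g) x x' - ((covFun P (pathwise k Xn y f) x x' : ℝ) : 𝕜) =
      ∑ o, ∑ o', ((updateCoeff k Xn x o * updateCoeff k Xn x' o' : ℝ) : 𝕜) *
        (covFun Pw g (updatePoint Xn x o) (updatePoint Xn x' o') -
          ((k (updatePoint Xn x o) (updatePoint Xn x' o') : ℝ) : 𝕜)) := by
    rw [covFun_pathwise k Xn y g hg, covFun_pathwise k Xn y f hf.memLp_two]
    simp_rw [hf.covFun_eq, mul_sub, Finset.sum_sub_distrib]
    push_cast
    rfl
  have henorm : ∀ r : ℝ, ‖(r : 𝕜)‖ₑ = ENNReal.ofReal |r| := by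
    intro r
    rw [← ofReal_norm, RCLike.norm_ofReal]
  beta_reduce
  rw [e]
  calc _ ≤ ∑ o, ∑ o', ENNReal.ofReal (|updateCoeff k Xn x o| * |updateCoeff k Xn x' o'|) *
        priorError k Pw g := by
        refine (enorm_sum_le _ _).trans (Finset.sum_le_sum fun o _ => ?_)
        refine (enorm_sum_le _ _).trans (Finset.sum_le_sum fun o' _ => ?_)
        rw [enorm_mul, henorm, abs_mul]
        gcongr
        exact le_supNorm (fun x x' => covFun Pw g x x' - ((k x x' : ℝ) : 𝕜)) _ _
    _ = ENNReal.ofReal ((∑ o, |updateCoeff k Xn x o|) * ∑ o', |updateCoeff k Xn x' o'|) *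
        priorError k Pw g := by
        rw [Finset.sum_mul_sum, ENNReal.ofReal_sum_of_nonneg fun o _ => by positivity,
          Finset.sum_mul]
        refine Finset.sum_congr rfl fun o _ => ?_
        rw [ENNReal.ofReal_sum_of_nonneg fun o _ => by positivity, Finset.sum_mul]
    _ ≤ _ := by
        gcongr
        have h1 := sum_abs_updateCoeff_le hk Xn x
        have h2 := sum_abs_updateCoeff_le hk Xn x'
        have h0 : 0 ≤ ∑ o, |updateCoeff k Xn x' o| := Finset.sum_nonneg fun _ _ => abs_nonneg _
        have hA := opNormInftyOne_nonneg (gram k Xn)⁻¹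
        rw [constTwo, sq]
        have hn' : (1 : ℝ) ≤ n := by exact_mod_cast hn
        calc _ ≤ (1 + opNormInftyOne (gram k Xn)⁻¹ * (supNorm k).toReal) *
              (1 + opNormInftyOne (gram k Xn)⁻¹ * (supNorm k).toReal) :=
              mul_le_mul h1 h2 h0 (by positivity)
          _ ≤ _ := le_mul_of_one_le_left (by positivity) hn'

/-! ### Linear models with Gaussian weights -/

lemma covFun_ofReal {X Ω 𝕜 : Type*} [RCLike 𝕜] [MeasurableSpace Ω] (P : Measure Ω)
    (g : X → Ω → ℝ) (x x' : X) :
    covFun P (fun x ω => ((g x ω : ℝ) : 𝕜)) x x' = ((cov[g x, g x'; P] : ℝ) : 𝕜) := by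
  simp only [covFun, covariance]
  simp_rw [integral_ofReal, ← RCLike.ofReal_sub, RCLike.conj_ofReal, ← RCLike.ofReal_mul]
  exact integral_ofReal

section LinearModel

variable {Ω : Type*} [MeasurableSpace Ω] {Pw : Measure Ω} {l : ℕ}
  {w : Ω → EuclideanSpace ℝ (Fin l)} {S : Matrix (Fin l) (Fin l) ℝ}

lemma memLp_two_weights (hw : HasLaw w (multivariateGaussian 0 S) Pw) (i : Fin l) :
    MemLp (fun ω => w ω i) 2 Pw := by
  have := hw.hasGaussianLaw
  have h := this.map (EuclideanSpace.proj (𝕜 := ℝ) i)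
  exact h.memLp_two

lemma memLp_two_linearModel {X 𝕜 : Type*} [RCLike 𝕜] (φ : Fin l → X → 𝕜)
    (hw : HasLaw w (multivariateGaussian 0 S) Pw) (x : X) :
    MemLp (linearModel φ w x) 2 Pw :=
  memLp_finsetSum _ fun i _ => ((memLp_two_weights hw i).ofReal (K := 𝕜)).mul_const _

lemma covFun_linearModel {X 𝕜 : Type*} [RCLike 𝕜] (φ : Fin l → X → 𝕜)
    (hw : HasLaw w (multivariateGaussian 0 1) Pw) [IsProbabilityMeasure Pw] (x x' : X) :
    covFun Pw (linearModel φ w) x x' = ∑ i, φ i x * (starRingEnd 𝕜) (φ i x') := by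
  have e : linearModel φ w = fun x ω => ∑ i, φ i x * ((w ω i : ℝ) : 𝕜) := by
    ext x ω; simp [linearModel, mul_comm]
  have hc : ∀ i j, cov[fun ω => w ω i, fun ω => w ω j; Pw] =
      (1 : Matrix (Fin l) (Fin l) ℝ) i j := by
    intro i j
    rw [← covariance_eval_multivariateGaussian (μ := 0) Matrix.PosSemidef.one i j]
    exact hw.covariance_fun_comp (f := fun v => v i) (g := fun v => v j)
      (by fun_prop) (by fun_prop)
  rw [e, covFun_sum (fun (i : Fin l) ω => ((w ω i : ℝ) : 𝕜))
    (fun i => (memLp_two_weights hw i).ofReal) (fun x i => φ i x) fun _ i => i]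
  simp_rw [covFun_ofReal Pw (fun i ω => w ω i), hc, Matrix.one_apply]
  simp

end LinearModel

/-! ### The law of the frequencies and of the phase -/

section SpectralDensity

variable {d : ℕ} {κ ρ : EuclideanSpace ℝ (Fin d) → ℝ}

lemma isProbabilityMeasure_phaseLaw : IsProbabilityMeasure phaseLaw := by
  have h : volume (Set.Ioo 0 (2 * Real.pi)) = ENNReal.ofReal (2 * Real.pi) := by simp
  refine cond_isProbabilityMeasure_of_finite ?_ ?_
  · rw [h]; simpa using Real.pi_pos
  · rw [h]; exact ENNReal.ofReal_ne_top

/-- A uniform phase averages out an oscillation. -/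
lemma integral_cos_add_two_mul_phaseLaw (c : ℝ) : ∫ τ, Real.cos (c + 2 * τ) ∂phaseLaw = 0 := by
  rw [phaseLaw, ProbabilityTheory.cond, integral_smul_measure, ← integral_Ioc_eq_integral_Ioo,
    ← intervalIntegral.integral_of_le (by positivity),
    intervalIntegral.integral_comp_add_mul _ two_ne_zero, integral_cos]
  have : Real.sin (c + 2 * (2 * Real.pi)) = Real.sin c := by
    have := Real.sin_add_nat_mul_two_pi c 2
    simpa using this
  simp [this]

/-- The spectral representation in real terms. -/
lemma IsSpectralDensity.integral_cos_sin (h : IsSpectralDensity κ ρ)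
    (t : EuclideanSpace ℝ (Fin d)) :
    ∫ ω, Real.cos (2 * Real.pi * ⟪ω, t⟫) * ρ ω = κ t ∧
      ∫ ω, Real.sin (2 * Real.pi * ⟪ω, t⟫) * ρ ω = 0 := by
  have hci : Integrable fun ω => Real.cos (2 * Real.pi * ⟪ω, t⟫) * ρ ω :=
    h.integrable.bdd_mul (c := 1) (by fun_prop)
      (Filter.Eventually.of_forall fun ω => Real.abs_cos_le_one _)
  have hsi : Integrable fun ω => Real.sin (2 * Real.pi * ⟪ω, t⟫) * ρ ω :=
    h.integrable.bdd_mul (c := 1) (by fun_prop)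
      (Filter.Eventually.of_forall fun ω => Real.abs_sin_le_one _)
  have e : ∀ ω, Complex.exp (2 * Real.pi * Complex.I * (⟪ω, t⟫ : ℝ)) * (ρ ω : ℂ) =
      ((Real.cos (2 * Real.pi * ⟪ω, t⟫) * ρ ω : ℝ) : ℂ) +
        ((Real.sin (2 * Real.pi * ⟪ω, t⟫) * ρ ω : ℝ) : ℂ) * Complex.I := by
    intro ω
    rw [show (2 * Real.pi * Complex.I * (⟪ω, t⟫ : ℝ) : ℂ) =
      ((2 * Real.pi * ⟪ω, t⟫ : ℝ) : ℂ) * Complex.I by push_cast; ring, Complex.exp_mul_I,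
      ← Complex.ofReal_cos, ← Complex.ofReal_sin]
    push_cast; ring
  have h0 := h.eq_integral t
  simp_rw [e] at h0
  rw [integral_add hci.ofReal (hsi.ofReal.mul_const _), integral_mul_const,
    integral_complex_ofReal, integral_complex_ofReal] at h0
  have hre := congrArg Complex.re h0
  have him := congrArg Complex.im h0
  simp at hre him
  exact ⟨hre.symm, him.symm⟩

lemma IsSpectralDensity.integral_eq (h : IsSpectralDensity κ ρ) : ∫ ω, ρ ω = κ 0 := by
  simpa using (h.integral_cos_sin 0).1

lemma IsSpectralDensity.apply_zero_nonneg (h : IsSpectralDensity κ ρ) : 0 ≤ κ 0 :=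
  h.integral_eq ▸ integral_nonneg h.nonneg

lemma IsSpectralDensity.isProbabilityMeasure_freqLaw (h : IsSpectralDensity κ ρ) (h0 : κ 0 ≠ 0) :
    IsProbabilityMeasure (freqLaw κ ρ) := by
  constructor
  rw [freqLaw, withDensity_apply _ MeasurableSet.univ, Measure.restrict_univ,
    ← ofReal_integral_eq_lintegral_ofReal (h.integrable.div_const _)
      (Filter.Eventually.of_forall fun ω => div_nonneg (h.nonneg ω) h.apply_zero_nonneg),
    integral_div, h.integral_eq, div_self h0, ENNReal.ofReal_one]

lemma IsSpectralDensity.integral_freqLaw (h : IsSpectralDensity κ ρ)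
    (g : EuclideanSpace ℝ (Fin d) → ℝ) :
    ∫ ω, g ω ∂freqLaw κ ρ = (∫ ω, g ω * ρ ω) / κ 0 := by
  rw [freqLaw, integral_withDensity_eq_integral_toReal_smul₀
    (h.integrable.div_const _).aestronglyMeasurable.aemeasurable.ennreal_ofReal
    (Filter.Eventually.of_forall fun _ => ENNReal.ofReal_lt_top), ← integral_div]
  refine integral_congr_ae (Filter.Eventually.of_forall fun ω => ?_)
  simp only [smul_eq_mul]
  rw [ENNReal.toReal_ofReal (div_nonneg (h.nonneg ω) h.apply_zero_nonneg)]
  ring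

/-- A Hölder constant of exponent `β ≤ 1` of the random features with frequency `ω`. The factor `32`
exceeds `8π`, which comes from their Lipschitz constants, and the bounds on their values. -/
noncomputable def freqHolder (β : ℝ) (ω : EuclideanSpace ℝ (Fin d)) : ℝ := 32 * (1 + ‖ω‖ ^ β)

lemma le_freqHolder (β : ℝ) (ω : EuclideanSpace ℝ (Fin d)) : 32 ≤ freqHolder β ω := by
  have : 0 ≤ ‖ω‖ ^ β := by positivity
  rw [freqHolder]; linarith

lemma measurable_freqHolder (β : ℝ) : Measurable (freqHolder (d := d) β) :=
  ((measurable_norm.pow_const β).const_add 1).const_mul 32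

/-- A spectral moment of order `α` makes the Hölder constant of any exponent `β ≤ α / 2`
square integrable. -/
lemma IsSpectralDensity.lintegral_freqHolder_sq_ne_top (h : IsSpectralDensity κ ρ) {α β : ℝ}
    (hβ : 0 < β) (hβα : 2 * β ≤ α) (hα : Integrable fun ω => ‖ω‖ ^ α * ρ ω) :
    ∫⁻ ω, ENNReal.ofReal (freqHolder β ω ^ 2) ∂freqLaw κ ρ ≠ ∞ := by
  rw [freqLaw, lintegral_withDensity_eq_lintegral_mul₀
    (h.integrable.div_const _).aestronglyMeasurable.aemeasurable.ennreal_ofReal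
    ((measurable_freqHolder β).pow_const 2).ennreal_ofReal.aemeasurable]
  have hi : Integrable fun ω => 2048 * (2 * ρ ω + ‖ω‖ ^ α * ρ ω) / κ 0 :=
    (((h.integrable.const_mul 2).add hα).const_mul 2048).div_const _
  refine ne_top_of_le_ne_top hi.lintegral_lt_top.ne (lintegral_mono fun ω => ?_)
  have hk := h.apply_zero_nonneg
  have hr := h.nonneg ω
  rw [Pi.mul_apply, ← ENNReal.ofReal_mul (div_nonneg hr hk)]
  refine ENNReal.ofReal_le_ofReal ?_
  rw [div_mul_eq_mul_div]
  refine div_le_div_of_nonneg_right ?_ hk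
  have hpow : (‖ω‖ ^ β) ^ 2 ≤ 1 + ‖ω‖ ^ α := by
    rw [← Real.rpow_natCast, ← Real.rpow_mul (norm_nonneg _)]
    rcases le_total ‖ω‖ 1 with h1 | h1
    · have := Real.rpow_le_one (norm_nonneg ω) h1 (show 0 ≤ β * (2 : ℕ) by push_cast; linarith)
      have : 0 ≤ ‖ω‖ ^ α := by positivity
      linarith
    · have := Real.rpow_le_rpow_of_exponent_le h1 (show β * (2 : ℕ) ≤ α by push_cast; linarith)
      linarith
  have : freqHolder β ω ^ 2 ≤ 2048 * (2 + ‖ω‖ ^ α) := by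
    rw [freqHolder]
    nlinarith [sq_nonneg (‖ω‖ ^ β - 1)]
  nlinarith

end SpectralDensity

/-! ### Hölder continuity of the random features -/

/-- A bounded Lipschitz increment is a Hölder increment. -/
lemma le_mul_rpow_of_le {Δ A u β : ℝ} (hA : 0 ≤ A) (hu : 0 ≤ u) (hβ0 : 0 < β) (hβ1 : β ≤ 1)
    (h1 : Δ ≤ A) (h2 : Δ ≤ A * u) : Δ ≤ A * u ^ β := by
  rcases le_total u 1 with h | h
  · refine h2.trans (mul_le_mul_of_nonneg_left ?_ hA)
    simpa using Real.rpow_le_rpow_of_exponent_ge' hu h hβ0.le hβ1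
  · exact h1.trans (le_mul_of_one_le_right hA (Real.one_le_rpow h hβ0.le))

section Features

variable {d : ℕ}

lemma abs_sub_le_freqHolder {β : ℝ} (hβ0 : 0 < β) (hβ1 : β ≤ 1) (ω : EuclideanSpace ℝ (Fin d))
    {Δ δ : ℝ} (hδ : 0 ≤ δ) (h1 : Δ ≤ 32) (h2 : Δ ≤ 8 * Real.pi * (‖ω‖ * δ)) :
    Δ ≤ freqHolder β ω * δ ^ β := by
  have hu : 0 ≤ ‖ω‖ * δ := by positivity
  have h3 : Δ ≤ 32 * (‖ω‖ * δ) := by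
    refine h2.trans (mul_le_mul_of_nonneg_right ?_ hu)
    linarith [Real.pi_le_four]
  have h4 := le_mul_rpow_of_le (by norm_num) hu hβ0 hβ1 h1 h3
  rw [Real.mul_rpow (norm_nonneg _) hδ] at h4
  rw [freqHolder]
  have : 0 ≤ δ ^ β := by positivity
  nlinarith

lemma abs_phase_sub_le (ω s t : EuclideanSpace ℝ (Fin d)) :
    |2 * Real.pi * ⟪ω, s⟫ - 2 * Real.pi * ⟪ω, t⟫| ≤ 2 * Real.pi * (‖ω‖ * dist s t) := by
  rw [← mul_sub, ← inner_sub_right, abs_mul, abs_of_nonneg (by positivity), dist_eq_norm]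
  gcongr
  exact abs_real_inner_le_norm _ _

lemma dist_fst_sub_snd_le (s t : EuclideanSpace ℝ (Fin d) × EuclideanSpace ℝ (Fin d)) :
    dist (s.1 - s.2) (t.1 - t.2) ≤ 2 * dist s t := by
  have h1 : dist s.1 t.1 ≤ dist s t := le_max_left _ _
  have h2 : dist s.2 t.2 ≤ dist s t := le_max_right _ _
  calc _ ≤ dist s.1 t.1 + dist s.2 t.2 := dist_sub_sub_le _ _ _ _
    _ ≤ _ := by linarith

lemma abs_cos_phase_sub_le {β : ℝ} (hβ0 : 0 < β) (hβ1 : β ≤ 1) (ω : EuclideanSpace ℝ (Fin d))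
    (s t : EuclideanSpace ℝ (Fin d) × EuclideanSpace ℝ (Fin d)) :
    |Real.cos (2 * Real.pi * ⟪ω, s.1 - s.2⟫) - Real.cos (2 * Real.pi * ⟪ω, t.1 - t.2⟫)| ≤
      freqHolder β ω * dist s t ^ β := by
  refine abs_sub_le_freqHolder hβ0 hβ1 ω dist_nonneg ?_ ?_
  · rw [abs_le]
    constructor <;> linarith [Real.neg_one_le_cos (2 * Real.pi * ⟪ω, s.1 - s.2⟫),
      Real.cos_le_one (2 * Real.pi * ⟪ω, s.1 - s.2⟫),
      Real.neg_one_le_cos (2 * Real.pi * ⟪ω, t.1 - t.2⟫),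
      Real.cos_le_one (2 * Real.pi * ⟪ω, t.1 - t.2⟫)]
  · refine (Real.abs_cos_sub_cos_le _ _).trans ((abs_phase_sub_le _ _ _).trans ?_)
    have := mul_le_mul_of_nonneg_left (dist_fst_sub_snd_le s t)
      (show 0 ≤ 2 * Real.pi * ‖ω‖ by positivity)
    have : 0 ≤ Real.pi * (‖ω‖ * dist s t) := by positivity
    linarith

lemma abs_sin_phase_sub_le {β : ℝ} (hβ0 : 0 < β) (hβ1 : β ≤ 1) (ω : EuclideanSpace ℝ (Fin d))
    (s t : EuclideanSpace ℝ (Fin d) × EuclideanSpace ℝ (Fin d)) :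
    |Real.sin (2 * Real.pi * ⟪ω, s.1 - s.2⟫) - Real.sin (2 * Real.pi * ⟪ω, t.1 - t.2⟫)| ≤
      freqHolder β ω * dist s t ^ β := by
  refine abs_sub_le_freqHolder hβ0 hβ1 ω dist_nonneg ?_ ?_
  · rw [abs_le]
    constructor <;> linarith [Real.neg_one_le_sin (2 * Real.pi * ⟪ω, s.1 - s.2⟫),
      Real.sin_le_one (2 * Real.pi * ⟪ω, s.1 - s.2⟫),
      Real.neg_one_le_sin (2 * Real.pi * ⟪ω, t.1 - t.2⟫),
      Real.sin_le_one (2 * Real.pi * ⟪ω, t.1 - t.2⟫)]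
  · refine (Real.abs_sin_sub_sin_le _ _).trans ((abs_phase_sub_le _ _ _).trans ?_)
    have := mul_le_mul_of_nonneg_left (dist_fst_sub_snd_le s t)
      (show 0 ≤ 2 * Real.pi * ‖ω‖ by positivity)
    have : 0 ≤ Real.pi * (‖ω‖ * dist s t) := by positivity
    linarith

/-- The product of two real features with frequency and phase `θ`, without its amplitude. -/
noncomputable def cosProd (θ : EuclideanSpace ℝ (Fin d) × ℝ)
    (s : EuclideanSpace ℝ (Fin d) × EuclideanSpace ℝ (Fin d)) : ℝ :=
  2 * (Real.cos (2 * Real.pi * ⟪θ.1, s.1⟫ + θ.2) * Real.cos (2 * Real.pi * ⟪θ.1, s.2⟫ + θ.2))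

lemma abs_cosProd_le (θ : EuclideanSpace ℝ (Fin d) × ℝ)
    (s : EuclideanSpace ℝ (Fin d) × EuclideanSpace ℝ (Fin d)) : |cosProd θ s| ≤ 2 := by
  rw [cosProd, abs_mul, abs_mul, abs_two]
  have := mul_le_one₀ (Real.abs_cos_le_one (2 * Real.pi * ⟪θ.1, s.1⟫ + θ.2)) (abs_nonneg _)
    (Real.abs_cos_le_one (2 * Real.pi * ⟪θ.1, s.2⟫ + θ.2))
  linarith

lemma measurable_cosProd (s : EuclideanSpace ℝ (Fin d) × EuclideanSpace ℝ (Fin d)) :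
    Measurable fun θ => cosProd θ s := by
  refine Continuous.measurable ?_
  unfold cosProd
  fun_prop

lemma abs_cosProd_sub_le {β : ℝ} (hβ0 : 0 < β) (hβ1 : β ≤ 1) (θ : EuclideanSpace ℝ (Fin d) × ℝ)
    (s t : EuclideanSpace ℝ (Fin d) × EuclideanSpace ℝ (Fin d)) :
    |cosProd θ s - cosProd θ t| ≤ freqHolder β θ.1 * dist s t ^ β := by
  refine abs_sub_le_freqHolder hβ0 hβ1 θ.1 dist_nonneg ?_ ?_
  · have h1 := abs_le.1 (abs_cosProd_le θ s)
    have h2 := abs_le.1 (abs_cosProd_le θ t)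
    rw [abs_le]
    constructor <;> linarith
  · have key : ∀ u v : EuclideanSpace ℝ (Fin d), dist u v ≤ dist s t →
        |Real.cos (2 * Real.pi * ⟪θ.1, u⟫ + θ.2) - Real.cos (2 * Real.pi * ⟪θ.1, v⟫ + θ.2)| ≤
          2 * Real.pi * (‖θ.1‖ * dist s t) := by
      intro u v huv
      refine (Real.abs_cos_sub_cos_le _ _).trans ?_
      rw [add_sub_add_right_eq_sub]
      exact (abs_phase_sub_le _ _ _).trans (by gcongr)
    have h1 := key s.1 t.1 (le_max_left _ _)
    have h2 := key s.2 t.2 (le_max_right _ _)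
    simp only [cosProd]
    generalize Real.pi * (‖θ.1‖ * dist s t) = M at *
    set a := Real.cos (2 * Real.pi * ⟪θ.1, s.1⟫ + θ.2)
    set a' := Real.cos (2 * Real.pi * ⟪θ.1, t.1⟫ + θ.2)
    set b := Real.cos (2 * Real.pi * ⟪θ.1, s.2⟫ + θ.2) with hb
    set b' := Real.cos (2 * Real.pi * ⟪θ.1, t.2⟫ + θ.2)
    have hb1 : |b| ≤ 1 := Real.abs_cos_le_one _
    have ha1 : |a'| ≤ 1 := Real.abs_cos_le_one _
    rw [show 2 * (a * b) - 2 * (a' * b') = 2 * ((a - a') * b + a' * (b - b')) by ring, abs_mul,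
      abs_two]
    have h3 : |(a - a') * b + a' * (b - b')| ≤ |a - a'| + |b - b'| := by
      refine (abs_add_le _ _).trans (add_le_add ?_ ?_) <;> rw [abs_mul]
      · exact mul_le_of_le_one_right (abs_nonneg _) hb1
      · exact mul_le_of_le_one_left (abs_nonneg _) ha1
    linarith

/-- Averaging over the phase turns the product of two real features into a function of the
difference of their arguments. -/
lemma integral_cosProd (ν : Measure (EuclideanSpace ℝ (Fin d))) [IsProbabilityMeasure ν]
    (s : EuclideanSpace ℝ (Fin d) × EuclideanSpace ℝ (Fin d)) :
    ∫ θ, cosProd θ s ∂ν.prod phaseLaw = ∫ ω, Real.cos (2 * Real.pi * ⟪ω, s.1 - s.2⟫) ∂ν := by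
  have := isProbabilityMeasure_phaseLaw
  rw [integral_prod _ (Integrable.of_bound (measurable_cosProd s).aestronglyMeasurable 2
    (Filter.Eventually.of_forall fun θ => abs_cosProd_le θ s))]
  refine integral_congr_ae (Filter.Eventually.of_forall fun ω => ?_)
  have e : ∀ τ, cosProd (ω, τ) s = Real.cos (2 * Real.pi * ⟪ω, s.1 - s.2⟫) +
      Real.cos ((2 * Real.pi * ⟪ω, s.1⟫ + 2 * Real.pi * ⟪ω, s.2⟫) + 2 * τ) := by
    intro τ
    simp only [cosProd]
    rw [← mul_assoc, Real.two_mul_cos_mul_cos, inner_sub_right]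
    congr 2 <;> ring
  simp_rw [e]
  rw [integral_add (integrable_const _), integral_cos_add_two_mul_phaseLaw]
  · simp
  · exact Integrable.of_bound (by fun_prop) 1
      (Filter.Eventually.of_forall fun τ => Real.abs_cos_le_one _)

end Features

/-! ### The rate for random Fourier features -/

section RandomFourierFeatures

variable {d l : ℕ} {X : Set (EuclideanSpace ℝ (Fin d))} {κ ρ : EuclideanSpace ℝ (Fin d) → ℝ}

lemma supNorm_subtype_le {E : Type*} [NormedAddCommGroup E] {c : X → X → E} {M : ℝ≥0∞}
    (G : EuclideanSpace ℝ (Fin d) × EuclideanSpace ℝ (Fin d) → ℝ≥0∞)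
    (hc : ∀ x x', ‖c x x'‖ₑ ≤ M * G (x, x')) : supNorm c ≤ M * ⨆ s ∈ X ×ˢ X, G s :=
  iSup_le fun x => iSup_le fun x' => (hc x x').trans <| mul_le_mul_right
    (le_iSup₂ (f := fun s (_ : s ∈ X ×ˢ X) => G s) ((x : EuclideanSpace ℝ (Fin d)), x'.1)
      ⟨x.2, x'.2⟩) _

/-- The covariance error of the complex features is the centred empirical mean of
`exp (2πi ⟪ω, x - x'⟫)`, split here into its real and imaginary parts. -/
lemma sum_rffComplex_sub_eq (h : IsSpectralDensity κ ρ) (h0 : κ 0 ≠ 0) (hl : 1 ≤ l)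
    (ω : Fin l → EuclideanSpace ℝ (Fin d)) (x x' : X) :
    ∑ j, rffComplex X κ ω j x * (starRingEnd ℂ) (rffComplex X κ ω j x') -
        ((statKernel X κ x x' : ℝ) : ℂ) =
      ((κ 0 / l : ℝ) : ℂ) *
        (((∑ j, (Real.cos (2 * Real.pi * ⟪ω j, x.1 - x'.1⟫) -
            ∫ v, Real.cos (2 * Real.pi * ⟪v, x.1 - x'.1⟫) ∂freqLaw κ ρ) : ℝ) : ℂ) +
          ((∑ j, (Real.sin (2 * Real.pi * ⟪ω j, x.1 - x'.1⟫) -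
            ∫ v, Real.sin (2 * Real.pi * ⟪v, x.1 - x'.1⟫) ∂freqLaw κ ρ) : ℝ) : ℂ) *
              Complex.I) := by
  have hl0 : (l : ℝ) ≠ 0 := by positivity
  have hterm : ∀ j, rffComplex X κ ω j x * (starRingEnd ℂ) (rffComplex X κ ω j x') =
      ((κ 0 / l : ℝ) : ℂ) * ((Real.cos (2 * Real.pi * ⟪ω j, x.1 - x'.1⟫) : ℂ) +
        (Real.sin (2 * Real.pi * ⟪ω j, x.1 - x'.1⟫) : ℂ) * Complex.I) := by
    intro j
    have hsq : ((Real.sqrt (κ 0 / l) : ℝ) : ℂ) * ((Real.sqrt (κ 0 / l) : ℝ) : ℂ) =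
        ((κ 0 / l : ℝ) : ℂ) := by
      rw [← Complex.ofReal_mul, Real.mul_self_sqrt (div_nonneg h.apply_zero_nonneg (by positivity))]
    simp only [rffComplex, map_mul, Complex.conj_ofReal, ← Complex.exp_conj, Complex.conj_I,
      map_ofNat]
    rw [mul_mul_mul_comm, hsq, ← Complex.exp_add, Complex.ofReal_cos, Complex.ofReal_sin,
      ← Complex.exp_mul_I, inner_sub_right]
    congr 2
    push_cast
    ring
  rw [h.integral_freqLaw, h.integral_freqLaw, (h.integral_cos_sin _).1, (h.integral_cos_sin _).2]
  simp_rw [hterm, ← Finset.mul_sum, Finset.sum_add_distrib, ← Finset.sum_mul,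
    Finset.sum_sub_distrib]
  have hk : ((statKernel X κ x x' : ℝ) : ℂ) =
      ((κ 0 / l : ℝ) : ℂ) * ((l * (κ (x.1 - x'.1) / κ 0) : ℝ) : ℂ) := by
    rw [← Complex.ofReal_mul]
    congr 1
    simp only [statKernel]
    field_simp
  rw [hk]
  simp only [Finset.sum_const, Finset.card_univ, Fintype.card_fin, nsmul_eq_mul]
  push_cast
  ring

/-- The covariance error of the real features is the centred empirical mean of `cosProd`. -/
lemma sum_rffReal_sub_eq (h : IsSpectralDensity κ ρ) (h0 : κ 0 ≠ 0) (hl : 1 ≤ l)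
    (θ : Fin l → EuclideanSpace ℝ (Fin d) × ℝ) (x x' : X) :
    ∑ j, rffReal X κ θ j x * (starRingEnd ℝ) (rffReal X κ θ j x') - statKernel X κ x x' =
      (κ 0 / l) * ∑ j, (cosProd (θ j) (x.1, x'.1) -
        ∫ v, cosProd v (x.1, x'.1) ∂(freqLaw κ ρ).prod phaseLaw) := by
  have := h.isProbabilityMeasure_freqLaw h0
  have hl0 : (l : ℝ) ≠ 0 := by positivity
  have hterm : ∀ j, rffReal X κ θ j x * (starRingEnd ℝ) (rffReal X κ θ j x') =
      (κ 0 / l) * cosProd (θ j) (x.1, x'.1) := by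
    intro j
    simp only [rffReal, conj_trivial, cosProd]
    rw [mul_mul_mul_comm, Real.mul_self_sqrt
      (div_nonneg (mul_nonneg zero_le_two h.apply_zero_nonneg) (by positivity))]
    ring
  rw [integral_cosProd, h.integral_freqLaw, (h.integral_cos_sin _).1]
  simp_rw [hterm, ← Finset.mul_sum, Finset.sum_sub_distrib, mul_sub]
  congr 1
  simp only [Finset.sum_const, Finset.card_univ, Fintype.card_fin, nsmul_eq_mul, statKernel]
  field_simp

/-- The expected uniform error of the random Fourier feature approximation of the kernel is of order
`l ^ (-1 / 2)`, with a constant that depends only on the kernel and on `X`. -/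
theorem exists_rff_const (hX : IsCompact X) (h : IsSpectralDensity κ ρ)
    (hα : ∃ α : ℝ, 0 < α ∧ Integrable fun ω => ‖ω‖ ^ α * ρ ω) :
    ∃ C₃ : ℝ, 0 ≤ C₃ ∧ ∀ l : ℕ, 1 ≤ l →
      ∀ (Ω : Type*) [MeasurableSpace Ω] (P : Measure Ω) [IsProbabilityMeasure P],
        (∀ ω : Fin l → Ω → EuclideanSpace ℝ (Fin d), iIndepFun ω P →
          (∀ j, HasLaw (ω j) (freqLaw κ ρ) P) →
          ∫⁻ p, supNorm (fun x x' : X => ∑ j, rffComplex X κ (fun j => ω j p) j x *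
              (starRingEnd ℂ) (rffComplex X κ (fun j => ω j p) j x') -
                ((statKernel X κ x x' : ℝ) : ℂ)) ∂P ≤
            ENNReal.ofReal ((l : ℝ) ^ (-(1 / 2) : ℝ) * C₃)) ∧
        (∀ θ : Fin l → Ω → EuclideanSpace ℝ (Fin d) × ℝ, iIndepFun θ P →
          (∀ j, HasLaw (θ j) ((freqLaw κ ρ).prod phaseLaw) P) →
          ∫⁻ p, supNorm (fun x x' : X => ∑ j, rffReal X κ (fun j => θ j p) j x *
              (starRingEnd ℝ) (rffReal X κ (fun j => θ j p) j x') - statKernel X κ x x') ∂P ≤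
            ENNReal.ofReal ((l : ℝ) ^ (-(1 / 2) : ℝ) * C₃)) := by
  by_cases h0 : κ 0 = 0
  · -- there are no random variables with the null law
    have hz : freqLaw κ ρ = 0 := by
      simp only [freqLaw, h0, div_zero, ENNReal.ofReal_zero]
      exact withDensity_zero
    refine ⟨0, le_rfl, fun l hl Ω _ P _ => ⟨fun ω _ hlaw => ?_, fun θ _ hlaw => ?_⟩⟩
    · have := (hlaw ⟨0, hl⟩).isProbabilityMeasure_iff.1 inferInstance
      rw [hz] at this
      exact absurd rfl this.ne_zero
    · have := (hlaw ⟨0, hl⟩).isProbabilityMeasure_iff.1 inferInstance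
      rw [hz, Measure.zero_prod] at this
      exact absurd rfl this.ne_zero
  obtain ⟨α, hα0, hα⟩ := hα
  have := h.isProbabilityMeasure_freqLaw h0
  have := isProbabilityMeasure_phaseLaw
  let β : ℝ := min 1 (α / 2)
  have hβ0 : 0 < β := lt_min one_pos (by positivity)
  have hβ1 : β ≤ 1 := min_le_left _ _
  have hβα : 2 * β ≤ α := by have : β ≤ α / 2 := min_le_right _ _; linarith
  obtain ⟨R, hR0, hR⟩ := (hX.prod hX).isBounded.subset_closedBall_lt 0 0
  obtain ⟨C, hC, hlaw⟩ := exists_uniform_law_const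
    (EuclideanSpace ℝ (Fin d) × EuclideanSpace ℝ (Fin d)) hR0 hβ0
  let W : ℝ≥0∞ := 1 + 4 * ∫⁻ ω, ENNReal.ofReal (freqHolder β ω ^ 2) ∂freqLaw κ ρ
  have hW : W ≠ ∞ := ENNReal.add_ne_top.2 ⟨ENNReal.one_ne_top, ENNReal.mul_ne_top (by norm_num)
    (h.lintegral_freqHolder_sq_ne_top hβ0 hβα hα)⟩
  obtain ⟨b, hb0, hb⟩ : ∃ b : ℝ, 0 ≤ b ∧ W = ENNReal.ofReal b :=
    ⟨W.toReal, ENNReal.toReal_nonneg, (ENNReal.ofReal_toReal hW).symm⟩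
  have hk0 := h.apply_zero_nonneg
  have hpos : ∀ ω : EuclideanSpace ℝ (Fin d), 0 < freqHolder β ω := fun ω => by
    linarith [le_freqHolder β ω]
  -- two sums, one each for the real and the imaginary part, account for the factor `2`
  have hfinal : ∀ l : ℕ, 1 ≤ l →
      ENNReal.ofReal (κ 0 / l) * (ENNReal.ofReal (C * √l) * W + ENNReal.ofReal (C * √l) * W) =
        ENNReal.ofReal ((l : ℝ) ^ (-(1 / 2) : ℝ) * (2 * κ 0 * C * b)) := by
    intro l hl
    have hl0 : (0 : ℝ) < l := by exact_mod_cast hl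
    rw [hb, ← ENNReal.ofReal_mul (by positivity),
      ← ENNReal.ofReal_add (by positivity) (by positivity), ← ENNReal.ofReal_mul (by positivity)]
    congr 1
    rw [Real.rpow_neg hl0.le, ← Real.sqrt_eq_rpow]
    have hs : √(l : ℝ) * √(l : ℝ) = l := Real.mul_self_sqrt hl0.le
    have hs0 : √(l : ℝ) ≠ 0 := (Real.sqrt_pos.2 hl0).ne'
    rw [show κ 0 / l = κ 0 / (√(l : ℝ) * √(l : ℝ)) by rw [hs]]
    field_simp
    ring
  have henorm : ∀ r : ℝ, ‖(r : ℂ)‖ₑ = ‖r‖ₑ := fun r => by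
    rw [← ofReal_norm, ← ofReal_norm, Complex.norm_real]
  have hI : ‖Complex.I‖ₑ = 1 := by rw [← ofReal_norm, Complex.norm_I, ENNReal.ofReal_one]
  refine ⟨2 * κ 0 * C * b, by positivity, fun l hl Ω _ P _ =>
    ⟨fun ω hind hω => ?_, fun θ hind hθ => ?_⟩⟩
  · let Zc : EuclideanSpace ℝ (Fin d) → EuclideanSpace ℝ (Fin d) × EuclideanSpace ℝ (Fin d) → ℝ :=
      fun v s => Real.cos (2 * Real.pi * ⟪v, s.1 - s.2⟫)
    let Zs : EuclideanSpace ℝ (Fin d) → EuclideanSpace ℝ (Fin d) × EuclideanSpace ℝ (Fin d) → ℝ :=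
      fun v s => Real.sin (2 * Real.pi * ⟪v, s.1 - s.2⟫)
    have hcm : ∀ s, Measurable fun v => Zc v s := fun s =>
      Continuous.measurable (by simp only [Zc]; fun_prop)
    have hsm : ∀ s, Measurable fun v => Zs v s := fun s =>
      Continuous.measurable (by simp only [Zs]; fun_prop)
    have hSc := hlaw (freqLaw κ ρ) P Zc (freqHolder β) 1 (X ×ˢ X) l ω hl hR hcm
      (fun v s => Real.abs_cos_le_one _) (measurable_freqHolder β) hpos
      (abs_cos_phase_sub_le hβ0 hβ1)
      (fun v => (Real.abs_cos_le_one _).trans (by linarith [le_freqHolder β v])) hind hω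
    have hSs := hlaw (freqLaw κ ρ) P Zs (freqHolder β) 1 (X ×ˢ X) l ω hl hR hsm
      (fun v s => Real.abs_sin_le_one _) (measurable_freqHolder β) hpos
      (abs_sin_phase_sub_le hβ0 hβ1)
      (fun v => (Real.abs_sin_le_one _).trans (by linarith [le_freqHolder β v])) hind hω
    have hcAE : AEMeasurable (fun p => ⨆ s ∈ X ×ˢ X,
        ‖∑ j, (Zc (ω j p) s - ∫ v, Zc v s ∂freqLaw κ ρ)‖ₑ) P := by
      have hm : Measurable fun e : Fin l → EuclideanSpace ℝ (Fin d) => ⨆ s ∈ X ×ˢ X,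
          ‖∑ j, (Zc (e j) s - ∫ v, Zc v s ∂freqLaw κ ρ)‖ₑ := by
        refine measurable_biSup_enorm _ (fun e => continuous_finsetSum _ fun j _ => ?_) fun s =>
          Finset.measurable_sum _ fun j _ => ((hcm s).comp (measurable_pi_apply j)).sub_const _
        refine Continuous.sub (by simp only [Zc]; fun_prop) ?_
        exact continuous_of_dominated (fun s => (hcm s).aestronglyMeasurable)
          (fun s => Filter.Eventually.of_forall fun v => Real.abs_cos_le_one _)
          (integrable_const 1)
          (Filter.Eventually.of_forall fun v => by simp only [Zc]; fun_prop)
      exact hm.comp_aemeasurable (aemeasurable_pi_lambda _ fun j => (hω j).aemeasurable)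
    calc _ ≤ ∫⁻ p, ENNReal.ofReal (κ 0 / l) * (
          (⨆ s ∈ X ×ˢ X, ‖∑ j, (Zc (ω j p) s - ∫ v, Zc v s ∂freqLaw κ ρ)‖ₑ) +
          ⨆ s ∈ X ×ˢ X, ‖∑ j, (Zs (ω j p) s - ∫ v, Zs v s ∂freqLaw κ ρ)‖ₑ) ∂P := by
          refine lintegral_mono fun p => ?_
          refine (supNorm_subtype_le (M := ENNReal.ofReal (κ 0 / l)) (fun s =>
            ‖∑ j, (Zc (ω j p) s - ∫ v, Zc v s ∂freqLaw κ ρ)‖ₑ +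
            ‖∑ j, (Zs (ω j p) s - ∫ v, Zs v s ∂freqLaw κ ρ)‖ₑ) fun x x' => ?_).trans ?_
          · rw [sum_rffComplex_sub_eq h h0 hl, enorm_mul]
            refine mul_le_mul' ?_ ((enorm_add_le _ _).trans ?_)
            · rw [henorm, Real.enorm_of_nonneg (by positivity)]
            · rw [enorm_mul, henorm, henorm, hI, mul_one]
          · refine mul_le_mul_right (iSup₂_le fun s hs => add_le_add ?_ ?_) _
            · exact le_iSup₂ (f := fun s (_ : s ∈ X ×ˢ X) =>
                ‖∑ j, (Zc (ω j p) s - ∫ v, Zc v s ∂freqLaw κ ρ)‖ₑ) s hs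
            · exact le_iSup₂ (f := fun s (_ : s ∈ X ×ˢ X) =>
                ‖∑ j, (Zs (ω j p) s - ∫ v, Zs v s ∂freqLaw κ ρ)‖ₑ) s hs
      _ ≤ ENNReal.ofReal (κ 0 / l) *
          (ENNReal.ofReal (C * √l) * W + ENNReal.ofReal (C * √l) * W) := by
          rw [lintegral_const_mul' _ _ ENNReal.ofReal_ne_top, lintegral_add_left' hcAE]
          exact mul_le_mul_right (add_le_add hSc hSs) _
      _ = _ := hfinal l hl
  · have hS := hlaw ((freqLaw κ ρ).prod phaseLaw) P cosProd (fun v => freqHolder β v.1) 2 (X ×ˢ X)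
      l θ hl hR measurable_cosProd abs_cosProd_le ((measurable_freqHolder β).comp measurable_fst)
      (fun v => hpos v.1) (abs_cosProd_sub_le hβ0 hβ1)
      (fun v => (abs_cosProd_le v 0).trans (by linarith [le_freqHolder β v.1])) hind hθ
    rw [(measurePreserving_fst (μ := freqLaw κ ρ) (ν := phaseLaw)).lintegral_comp
      ((measurable_freqHolder β).pow_const 2).ennreal_ofReal] at hS
    calc _ ≤ ∫⁻ p, ENNReal.ofReal (κ 0 / l) *
          ⨆ s ∈ X ×ˢ X, ‖∑ j, (cosProd (θ j p) s -
            ∫ v, cosProd v s ∂(freqLaw κ ρ).prod phaseLaw)‖ₑ ∂P := by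
          refine lintegral_mono fun p => ?_
          refine supNorm_subtype_le (M := ENNReal.ofReal (κ 0 / l)) (fun s =>
            ‖∑ j, (cosProd (θ j p) s - ∫ v, cosProd v s ∂(freqLaw κ ρ).prod phaseLaw)‖ₑ)
            fun x x' => ?_
          rw [sum_rffReal_sub_eq h h0 hl, enorm_mul, Real.enorm_of_nonneg (by positivity)]
      _ ≤ ENNReal.ofReal (κ 0 / l) * (ENNReal.ofReal (C * √l) * W) := by
          rw [lintegral_const_mul' _ _ ENNReal.ofReal_ne_top]
          exact mul_le_mul_right hS _
      _ ≤ ENNReal.ofReal (κ 0 / l) *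
          (ENNReal.ofReal (C * √l) * W + ENNReal.ofReal (C * √l) * W) :=
          mul_le_mul_right le_self_add _
      _ = _ := hfinal l hl

end RandomFourierFeatures

end PathwiseGP

theorem mainTheorem4 {d : ℕ} (X : Set (EuclideanSpace ℝ (Fin d))) (hX : IsCompact X)
    (κ : EuclideanSpace ℝ (Fin d) → ℝ)
    {Ω : Type*} [MeasurableSpace Ω] (P : Measure Ω) [IsProbabilityMeasure P]
    (f : X → Ω → ℝ) (μ : X → ℝ)
    (hf : IsGP P f μ (statKernel X κ))
    (hcont : ∀ᵐ ω ∂P, Continuous fun x => f x ω) :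
    -- the covariance function of the pathwise posterior is the conditional covariance of `f`
    (∀ (n : ℕ) (Xn : Fin n → X) (y : Fin n → ℝ), IsUnit (gram (statKernel X κ) Xn).det →
      ∀ x x' : X, condCov P f Xn x x' =ᵐ[P]
        fun _ => covFun P (pathwise (statKernel X κ) Xn y f) x x') ∧
    -- the bound for a general approximate prior
    (∀ (n : ℕ) (Xn : Fin n → X) (y : Fin n → ℝ), 1 ≤ n →
      IsUnit (gram (statKernel X κ) Xn).det →
      ∀ (𝕜 : Type*) [RCLike 𝕜] (l : ℕ) (S : Matrix (Fin l) (Fin l) ℝ), S.PosSemidef →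
      ∀ (Ωw : Type*) [MeasurableSpace Ωw] (Pw : Measure Ωw) [IsProbabilityMeasure Pw]
        (w : Ωw → EuclideanSpace ℝ (Fin l)), HasLaw w (multivariateGaussian 0 S) Pw →
      ∀ (Ωφ : Type*) [MeasurableSpace Ωφ] (Pφ : Measure Ωφ) [IsProbabilityMeasure Pφ]
        (φ : Ωφ → Fin l → X → 𝕜), (∀ i x, Measurable fun p => φ p i x) →
        (∀ p i, Continuous (φ p i)) →
        ∫⁻ p, posteriorError (statKernel X κ) Xn y P f Pw (linearModel (φ p) w) ∂Pφ ≤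
          ENNReal.ofReal (constTwo (statKernel X κ) Xn) *
            ∫⁻ p, priorError (statKernel X κ) Pw (linearModel (φ p) w) ∂Pφ) ∧
    -- the rate for random Fourier features
    (∀ ρ : EuclideanSpace ℝ (Fin d) → ℝ, IsSpectralDensity κ ρ →
      (∃ α : ℝ, 0 < α ∧ Integrable fun ω => ‖ω‖ ^ α * ρ ω) →
      ∃ C₃ : ℝ, 0 ≤ C₃ ∧
        ∀ (l : ℕ), 1 ≤ l →
        ∀ (Ωw : Type*) [MeasurableSpace Ωw] (Pw : Measure Ωw) [IsProbabilityMeasure Pw]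
          (w : Ωw → EuclideanSpace ℝ (Fin l)), HasLaw w (multivariateGaussian 0 1) Pw →
        ∀ (Ωφ : Type*) [MeasurableSpace Ωφ] (Pφ : Measure Ωφ) [IsProbabilityMeasure Pφ],
          (∀ ω : Fin l → Ωφ → EuclideanSpace ℝ (Fin d), (∀ j, Measurable (ω j)) →
            iIndepFun ω Pφ → (∀ j, HasLaw (ω j) (freqLaw κ ρ) Pφ) →
            ∫⁻ p, priorError (statKernel X κ) Pw
                (linearModel (rffComplex X κ fun j => ω j p) w) ∂Pφ ≤
              ENNReal.ofReal ((l : ℝ) ^ (-(1 / 2) : ℝ) * C₃) ∧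
            ∀ (n : ℕ) (Xn : Fin n → X) (y : Fin n → ℝ), 1 ≤ n →
              IsUnit (gram (statKernel X κ) Xn).det →
              ∫⁻ p, posteriorError (statKernel X κ) Xn y P f Pw
                  (linearModel (rffComplex X κ fun j => ω j p) w) ∂Pφ ≤
                ENNReal.ofReal ((l : ℝ) ^ (-(1 / 2) : ℝ) *
                  constTwo (statKernel X κ) Xn * C₃)) ∧
          (∀ θ : Fin l → Ωφ → EuclideanSpace ℝ (Fin d) × ℝ, (∀ j, Measurable (θ j)) →
            iIndepFun θ Pφ → (∀ j, HasLaw (θ j) ((freqLaw κ ρ).prod phaseLaw) Pφ) →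
            ∫⁻ p, priorError (statKernel X κ) Pw
                (linearModel (rffReal X κ fun j => θ j p) w) ∂Pφ ≤
              ENNReal.ofReal ((l : ℝ) ^ (-(1 / 2) : ℝ) * C₃) ∧
            ∀ (n : ℕ) (Xn : Fin n → X) (y : Fin n → ℝ), 1 ≤ n →
              IsUnit (gram (statKernel X κ) Xn).det →
              ∫⁻ p, posteriorError (statKernel X κ) Xn y P f Pw
                  (linearModel (rffReal X κ fun j => θ j p) w) ∂Pφ ≤
                ENNReal.ofReal ((l : ℝ) ^ (-(1 / 2) : ℝ) *
                  constTwo (statKernel X κ) Xn * C₃))) := by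
  have hk := hf.supNorm_statKernel_ne_top
  refine ⟨fun n Xn y hK x x' => hf.condCov_ae_eq Xn y hK x x', ?_, ?_⟩
  · intro n Xn y hn _ 𝕜 _ l S _ Ωw _ Pw _ w hw Ωφ _ Pφ _ φ _ _
    rw [← lintegral_const_mul' _ _ ENNReal.ofReal_ne_top]
    exact lintegral_mono fun p =>
      hf.posteriorError_le hk hn Xn y _ (memLp_two_linearModel (φ p) hw)
  · intro ρ hρ hα
    obtain ⟨C₃, hC₃, hrff⟩ := exists_rff_const hX hρ hα
    refine ⟨C₃, hC₃, fun l hl Ωw _ Pw _ w hw Ωφ _ Pφ _ => ?_⟩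
    -- the bound on the posterior error follows from that on the prior error
    have hpost : ∀ {𝕜 : Type} [RCLike 𝕜] (φ : Ωφ → Fin l → X → 𝕜),
        ∫⁻ p, priorError (statKernel X κ) Pw (linearModel (φ p) w) ∂Pφ ≤
          ENNReal.ofReal ((l : ℝ) ^ (-(1 / 2) : ℝ) * C₃) →
        ∀ (n : ℕ) (Xn : Fin n → X) (y : Fin n → ℝ), 1 ≤ n →
          ∫⁻ p, posteriorError (statKernel X κ) Xn y P f Pw (linearModel (φ p) w) ∂Pφ ≤
            ENNReal.ofReal ((l : ℝ) ^ (-(1 / 2) : ℝ) * constTwo (statKernel X κ) Xn * C₃) := by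
      intro 𝕜 _ φ hφ n Xn y hn
      calc _ ≤ ∫⁻ p, ENNReal.ofReal (constTwo (statKernel X κ) Xn) *
            priorError (statKernel X κ) Pw (linearModel (φ p) w) ∂Pφ :=
            lintegral_mono fun p =>
              hf.posteriorError_le hk hn Xn y _ (memLp_two_linearModel (φ p) hw)
        _ ≤ ENNReal.ofReal (constTwo (statKernel X κ) Xn) *
            ENNReal.ofReal ((l : ℝ) ^ (-(1 / 2) : ℝ) * C₃) := by
            rw [lintegral_const_mul' _ _ ENNReal.ofReal_ne_top]
            gcongr
        _ = _ := by
            rw [← ENNReal.ofReal_mul (constTwo_nonneg _ _)]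
            congr 1
            ring
    refine ⟨fun ω _ hind hlaw => ?_, fun θ _ hind hlaw => ?_⟩
    · have h : ∫⁻ p, priorError (statKernel X κ) Pw
          (linearModel (rffComplex X κ fun j => ω j p) w) ∂Pφ ≤
            ENNReal.ofReal ((l : ℝ) ^ (-(1 / 2) : ℝ) * C₃) := by
        simp only [priorError, covFun_linearModel _ hw]
        exact (hrff l hl Ωφ Pφ).1 ω hind hlaw
      exact ⟨h, fun n Xn y hn _ => hpost _ h n Xn y hn⟩
    · have h : ∫⁻ p, priorError (statKernel X κ) Pw
          (linearModel (rffReal X κ fun j => θ j p) w) ∂Pφ ≤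
            ENNReal.ofReal ((l : ℝ) ^ (-(1 / 2) : ℝ) * C₃) := by
        simp only [priorError, covFun_linearModel _ hw]
        exact (hrff l hl Ωφ Pφ).2 θ hind hlaw
      exact ⟨h, fun n Xn y hn _ => hpost _ h n Xn y hn⟩
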